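/- **Setting.** Let $d\in\mathbb N$, $\alpha>0$, $C_1\in\mathbb R$, and let $\sigma_0:\mathbb R\to\mathbb R$ be twice differentiable with $|\sigma_0(t)|\le C_1\max(|t|,1)$, $|\sigma_0'(t)|\le C_1$, $|\sigma_0''(t)|\le C_1$ for all $t$. For $z\in\mathbb R^d$ put $\sigma(z,\theta)=u\,\sigma_0(w^\top z+b)\in\mathbb R^d$ for $\theta=(u,w,b)\in\mathbb R^{2d+1}$, and $h(z,\omega)=a\,\sigma_0(w^\top z+b)\in\mathbb R$ for $\omega=(a,w,b)\in\mathbb R^{d+2}$. Let $C_{\max}<1$, $n\ge 1$ and $x_1,\dots,x_n\in\mathbb R^d$ with $\|x_i\|_2=1$ for all $i$ and $\langle x_i,x_j\rangle\le C_{\max}$ for $i\ne j$. Let $\mathcal P^2$ be the set of probability measures with finite second moment, $\mathcal W_2$ the 2-Wasserstein distance, and $\mathcal C(\mathcal P^2;[0,1])$ the set of families $\nu=(\nu^s)_{s\in[0,1]}$ in $\mathcal P^2$ that are $\mathcal W_2$-continuous in $s$, with $\mathcal W_2(\nu,\nu')=\sup_{s\in[0,1]}\mathcal W_2(\nu^s,\nu'^s)$.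 For a measure $\tau\in\mathcal P^2$ on $\mathbb R^{d+2}$ and a family $\nu\in\mathcal C(\mathcal P^2;[0,1])$ of measures on $\mathbb R^{2d+1}$ let $Z_\nu(x,\cdot)$ and $p_\nu(x,\cdot)$ be the solutions on $[0,1]$ of $$\tfrac{d}{ds}Z_\nu(x,s)=\alpha\int\sigma(Z_\nu(x,s),\theta)\,d\nu^s(\theta),\qquad Z_\nu(x,0)=x,$$ $$\tfrac{d}{ds}p_\nu^\top(x,s)=-\alpha\,p_\nu^\top(x,s)\int\nabla_z\sigma(Z_\nu(x,s),\theta)\,d\nu^s(\theta),\qquad p_\nu(x,1)=\int\nabla_z h(Z_\nu(x,1),\omega)\,d\tau(\omega).$$ Define the $n\times n$ matrices $G_1(\tau,\nu)=\int_0^1\int J_1J_1^\top d\nu^s(\theta)\,ds$, where $J_1$ has rows $p_\nu^\top(x_i,s)\nabla_\theta\sigma(Z_\nu(x_i,s),\theta)$; $G_2(\tau,\nu)=\int J_2J_2^\top d\tau(\omega)$, where $J_2$ has rows $\nabla_\omega h(Z_\nu(x_i,1),\omega)$; and $G=\alpha^2G_1+G_2$. Let $\tau_0$ be the standard Gaussian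 on $\mathbb R^{d+2}$, let $\nu_0^s$ be the standard Gaussian on $\mathbb R^{2d+1}$ for every $s$, and put $\lambda_0=\lambda_{\min}(G(\tau_0,\nu_0))$. **Statement.** There are constants $C_G=C_G(d,\alpha)>0$, depending only on $d$, $\alpha$ and $C_1$, and $\Lambda=\Lambda(d)\ge 0$, depending only on $d$, $\sigma_0$, $C_1$ and $C_{\max}$, with $\Lambda>0$ whenever $\sigma_0$ is not an affine function, such that for all data $x_1,\dots,x_n$ as above: 1. $\lambda_0\ge\lambda_{\min}(G_2(\tau_0,\nu_0))\ge\Lambda$. 2. If $\tau\in\mathcal P^2$ and $\nu\in\mathcal C(\mathcal P^2;[0,1])$ satisfy $\mathcal W_2(\nu,\nu_0)\le\sqrt d$ and $\mathcal W_2(\tau,\tau_0)\le\sqrt d$, then for all $i,j$ $$|G_2(\tau,\nu)_{ij}-G_2(\tau_0,\nu_0)_{ij}|\le C_G\,\big(\mathcal W_2(\nu,\nu_0)+\mathcal W_2(\tau,\tau_0)\big).$$ 3. With $r_{\max}=\min\{\sqrt d,\ \Lambda/(4nC_G)\}$: if $\tau\in\mathcal P^2$ and $\nu\in\mathcal C(\mathcal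 P^2;[0,1])$ satisfy $\mathcal W_2(\nu,\nu_0)\le r_{\max}$ and $\mathcal W_2(\tau,\tau_0)\le r_{\max}$, then $\lambda_{\min}(G_2(\tau,\nu))\ge\lambda_0/2$, and in particular $\lambda_{\min}(G_2(\tau,\nu))\ge\Lambda/2$. -/

import Mathlib

noncomputable section

namespace MeanFieldResNet

open MeasureTheory ProbabilityTheory Set Filter Topology

/-! ### Probability measures with finite second moment and the Wasserstein distance -/

/-- The measure `μ` is a probability measure with finite second moment. -/
def IsP2 {E : Type*} [NormedAddCommGroup E] [MeasurableSpace E] (μ : Measure E) : Prop :=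
  IsProbabilityMeasure μ ∧ MemLp (fun x : E => x) 2 μ

/-- `π` is a coupling of `μ` and `ν`. -/
def IsCoupling {E : Type*} [MeasurableSpace E] (μ ν : Measure E) (π : Measure (E × E)) : Prop :=
  π.map Prod.fst = μ ∧ π.map Prod.snd = ν

/-- The 2-Wasserstein distance: the square root of the infimum of `∫ ‖x - y‖² dπ(x, y)` over the
couplings `π`. -/
def W2 {E : Type*} [NormedAddCommGroup E] [MeasurableSpace E] (μ ν : Measure E) : ENNReal :=
  (⨅ (π : Measure (E × E)) (_ : IsCoupling μ ν π), ∫⁻ p, ‖p.1 - p.2‖ₑ ^ 2 ∂π) ^ (1 / 2 : ℝ)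

/-- The distance `sup_{s ∈ [0,1]} W₂(μ^s, ν^s)` between families of measures over `[0,1]`. -/
def W2sup {E : Type*} [NormedAddCommGroup E] [MeasurableSpace E] (μ ν : ℝ → Measure E) : ENNReal :=
  ⨆ s ∈ Icc (0 : ℝ) 1, W2 (μ s) (ν s)

/-- The class `𝒞(𝒫²; [0,1])`: each `ν^s`, `s ∈ [0,1]`, is a probability measure with finite second
moment, and `s ↦ ν^s` is continuous on `[0,1]` for `W₂`. Values outside `[0,1]` are never used. -/
def IsCP2 {E : Type*} [NormedAddCommGroup E] [MeasurableSpace E] (ν : ℝ → Measure E) : Prop :=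
  (∀ s ∈ Icc (0 : ℝ) 1, IsP2 (ν s)) ∧
    ∀ s ∈ Icc (0 : ℝ) 1, Tendsto (fun t => W2 (ν t) (ν s)) (𝓝[Icc (0 : ℝ) 1] s) (𝓝 0)

/-! ### Parameters, residual blocks and predictor -/

abbrev Vec (d : ℕ) : Type := EuclideanSpace ℝ (Fin d)

/-- Indices of the coordinates of `θ = (u, w, b) ∈ ℝ^(2d+1)`. -/
abbrev ResIdx (d : ℕ) : Type := Fin d ⊕ Fin d ⊕ Unit

/-- The space `ℝ^(2d+1)` of the parameters `θ = (u, w, b)`, with its Euclidean norm. -/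
abbrev ResParam (d : ℕ) : Type := EuclideanSpace ℝ (ResIdx d)

/-- Indices of the coordinates of `ω = (a, w, b) ∈ ℝ^(d+2)`. -/
abbrev HeadIdx (d : ℕ) : Type := Unit ⊕ Fin d ⊕ Unit

/-- The space `ℝ^(d+2)` of the parameters `ω = (a, w, b)`, with its Euclidean norm. -/
abbrev HeadParam (d : ℕ) : Type := EuclideanSpace ℝ (HeadIdx d)

/-- `σ(z, θ) = u σ₀(wᵀ z + b)` for `θ = (u, w, b)`. -/
def resBlock {d : ℕ} (σ₀ : ℝ → ℝ) (z : Vec d) (θ : ResParam d) : Vec d :=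
  WithLp.toLp 2 fun k =>
    θ (Sum.inl k) * σ₀ ((∑ i, θ (Sum.inr (Sum.inl i)) * z i) + θ (Sum.inr (Sum.inr ())))

/-- `h(z, ω) = a σ₀(wᵀ z + b)` for `ω = (a, w, b)`. -/
def head {d : ℕ} (σ₀ : ℝ → ℝ) (z : Vec d) (ω : HeadParam d) : ℝ :=
  ω (Sum.inl ()) * σ₀ ((∑ i, ω (Sum.inr (Sum.inl i)) * z i) + ω (Sum.inr (Sum.inr ())))

/-- The assumptions on the scalar activation `σ₀`: it is twice differentiable,
`|σ₀(t)| ≤ C₁ max(|t|, 1)`, `|σ₀'| ≤ C₁` and `|σ₀''| ≤ C₁`. -/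
structure IsActivation (C₁ : ℝ) (σ₀ : ℝ → ℝ) : Prop where
  differentiable : Differentiable ℝ σ₀
  differentiable_deriv : Differentiable ℝ (deriv σ₀)
  growth : ∀ t, |σ₀ t| ≤ C₁ * max |t| 1
  deriv_le : ∀ t, |deriv σ₀ t| ≤ C₁
  deriv2_le : ∀ t, |deriv (deriv σ₀) t| ≤ C₁

/-- The data points are unit vectors whose pairwise inner products are at most `Cmax`. -/
def IsData {d n : ℕ} (Cmax : ℝ) (x : Fin n → Vec d) : Prop :=
  (∀ i, ‖x i‖ = 1) ∧ ∀ i j, i ≠ j → inner ℝ (x i) (x j) ≤ Cmax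

/-! ### The forward and the adjoint equation -/

/-- `z` solves `dz/ds = α ∫ σ(z(s), θ) dν^s(θ)` on `[0,1]` with `z(0) = x`. -/
def IsForward {d : ℕ} (α : ℝ) (σ₀ : ℝ → ℝ) (ν : ℝ → Measure (ResParam d)) (x : Vec d)
    (z : ℝ → Vec d) : Prop :=
  z 0 = x ∧ ∀ s ∈ Icc (0 : ℝ) 1,
    HasDerivWithinAt z (α • ∫ θ, resBlock σ₀ (z s) θ ∂(ν s)) (Icc 0 1) s

open Classical in
/-- The solution `Z_ν(x, ·)` of the forward equation (a placeholder if there is none). -/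
def Z {d : ℕ} (α : ℝ) (σ₀ : ℝ → ℝ) (ν : ℝ → Measure (ResParam d)) (x : Vec d) : ℝ → Vec d :=
  if h : ∃ z, IsForward α σ₀ ν x z then h.choose else fun _ => x

/-- `p` solves the adjoint equation
`dpᵀ/ds = -α pᵀ ∫ ∇_z σ(Z_ν(x, s), θ) dν^s(θ)` on `[0,1]`, with
`p(1) = ∫ ∇_z h(Z_ν(x, 1), ω) dτ(ω)`. -/
def IsAdjoint {d : ℕ} (α : ℝ) (σ₀ : ℝ → ℝ) (τ : Measure (HeadParam d))
    (ν : ℝ → Measure (ResParam d)) (x : Vec d) (p : ℝ → Vec d) : Prop :=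
  p 1 = ∫ ω, gradient (fun z => head σ₀ z ω) (Z α σ₀ ν x 1) ∂τ ∧
  ∀ s ∈ Icc (0 : ℝ) 1,
    HasDerivWithinAt p
      (-(α • ContinuousLinearMap.adjoint
          (∫ θ, fderiv ℝ (fun z => resBlock σ₀ z θ) (Z α σ₀ ν x s) ∂(ν s)) (p s)))
      (Icc 0 1) s

open Classical in
/-- The solution `p_ν(x, ·)` of the adjoint equation (a placeholder if there is none). -/
def P {d : ℕ} (α : ℝ) (σ₀ : ℝ → ℝ) (τ : Measure (HeadParam d)) (ν : ℝ → Measure (ResParam d))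
    (x : Vec d) : ℝ → Vec d :=
  if h : ∃ p, IsAdjoint α σ₀ τ ν x p then h.choose else fun _ => 0

/-! ### Gram matrices -/

/-- The matrix `J₁(τ, ν, θ, s)`, with rows `p_ν(x_i, s)ᵀ ∇_θ σ(Z_ν(x_i, s), θ)`. -/
def J1 {d n : ℕ} (α : ℝ) (σ₀ : ℝ → ℝ) (x : Fin n → Vec d) (τ : Measure (HeadParam d))
    (ν : ℝ → Measure (ResParam d)) (θ : ResParam d) (s : ℝ) : Matrix (Fin n) (ResIdx d) ℝ :=
  Matrix.of fun i k => inner ℝ (P α σ₀ τ ν (x i) s)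
    (fderiv ℝ (resBlock σ₀ (Z α σ₀ ν (x i) s)) θ (EuclideanSpace.single k 1))

/-- `G₁(τ, ν) = ∫₀¹ ∫ J₁ J₁ᵀ dν^s(θ) ds`. -/
def G1 {d n : ℕ} (α : ℝ) (σ₀ : ℝ → ℝ) (x : Fin n → Vec d) (τ : Measure (HeadParam d))
    (ν : ℝ → Measure (ResParam d)) : Matrix (Fin n) (Fin n) ℝ :=
  Matrix.of fun i j => ∫ s in (0 : ℝ)..1, ∫ θ,
    (J1 α σ₀ x τ ν θ s * (J1 α σ₀ x τ ν θ s).transpose) i j ∂(ν s)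

/-- The matrix `J₂(ν, ω)`, with rows `∇_ω h(Z_ν(x_i, 1), ω)`. -/
def J2 {d n : ℕ} (α : ℝ) (σ₀ : ℝ → ℝ) (x : Fin n → Vec d) (ν : ℝ → Measure (ResParam d))
    (ω : HeadParam d) : Matrix (Fin n) (HeadIdx d) ℝ :=
  Matrix.of fun i k => gradient (head σ₀ (Z α σ₀ ν (x i) 1)) ω k

/-- `G₂(τ, ν) = ∫ J₂ J₂ᵀ dτ(ω)`. -/
def G2 {d n : ℕ} (α : ℝ) (σ₀ : ℝ → ℝ) (x : Fin n → Vec d) (τ : Measure (HeadParam d))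
    (ν : ℝ → Measure (ResParam d)) : Matrix (Fin n) (Fin n) ℝ :=
  Matrix.of fun i j => ∫ ω, (J2 α σ₀ x ν ω * (J2 α σ₀ x ν ω).transpose) i j ∂τ

/-- The full Gram matrix `G = α² G₁ + G₂`. -/
def G {d n : ℕ} (α : ℝ) (σ₀ : ℝ → ℝ) (x : Fin n → Vec d) (τ : Measure (HeadParam d))
    (ν : ℝ → Measure (ResParam d)) : Matrix (Fin n) (Fin n) ℝ :=
  α ^ 2 • G1 α σ₀ x τ ν + G2 α σ₀ x τ ν

/-- The smallest (real) eigenvalue; it is applied to symmetric matrices of size `n ≥ 1` only. -/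
def lambdaMin {n : ℕ} (A : Matrix (Fin n) (Fin n) ℝ) : ℝ := sInf (spectrum ℝ A)

/-! ### Initialization and radius -/

/-- `τ₀`, the standard Gaussian on `ℝ^(d+2)`. -/
def tau0 (d : ℕ) : Measure (HeadParam d) := stdGaussian (HeadParam d)

/-- `ν₀`, with `ν₀^s` the standard Gaussian on `ℝ^(2d+1)` for every `s`. -/
def nu0 (d : ℕ) : ℝ → Measure (ResParam d) := fun _ => stdGaussian (ResParam d)

/-- `r_max = min {√d, Λ / (4 n C_G)}`. -/
def rMax (d n : ℕ) (Λ CG : ℝ) : ℝ := min (Real.sqrt d) (Λ / (4 * n * CG))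

end MeanFieldResNet

end

namespace MeanFieldResNet

open MeasureTheory ProbabilityTheory Set Filter Topology

/-! The outer weights `u` and `a` enter linearly and the Gaussian is symmetric under changing their
sign. At initialization the drift of the forward equation and the terminal value of the adjoint
equation therefore vanish (`integral_stdGaussian_eq_zero_of_odd`). Hence the state stays at `x`, the
adjoint is zero, `G1` is zero and `G` equals `G2`, so only the head matters. No existence or
uniqueness theory for the two equations is needed: every estimate holds for any solution and also
for the placeholder.

At initialization `G2` is the Gram matrix, in L² of the Gaussian, of the gradients of the head at
the data points. If its quadratic form vanishes at `v`, continuity and full support make `∑ vᵢ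
∇h(xᵢ, ω)` zero for every `ω`. Its bias coordinate is a linear relation between the ridge functions
`σ₀'(w·xᵢ + b)`, and `ridge_const` shows that such a relation with some `vᵢ ≠ 0` forces `σ₀'` to be
constant (`gaussForm_pos`). Compactness gives a uniform bound for each `n`. Separated unit vectors
are bounded in number (`exists_card_le_of_isData`), so only finitely many `n` occur and the bound
depends neither on `n` nor on the data. In the affine case `Λ = 0` works.

For the perturbation, the integrands are locally Lipschitz with quadratic growth, so a coupling
bounds the change of their integrals linearly in `W2` (`QuadLip.norm_integral_sub_le`). Applied to
the drift, with Grönwall, this keeps the final state near `x`; applied to the kernel, it bounds the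
entries of `G2` (`abs_G2_sub_le`). An entrywise error `ε` moves the smallest eigenvalue by at most
`n ε` (`lambdaMin_sub_le`), and the radius makes this at most `Λ / 2 ≤ λ₀ / 2`. -/

/-! ### Elementary estimates for parameters and activations -/

/-- The linear form `(·, w, b) ↦ wᵀ z + b` on parameter space. -/
noncomputable def affineForm {ι : Type*} [Fintype ι] {d : ℕ} (z : Vec d) :
    EuclideanSpace ℝ (ι ⊕ Fin d ⊕ Unit) →L[ℝ] ℝ :=
  ∑ i, z i • EuclideanSpace.proj (Sum.inr (Sum.inl i)) + EuclideanSpace.proj (Sum.inr (Sum.inr ()))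

section
variable {ι : Type*} [Fintype ι] {d : ℕ}

lemma affineForm_apply (z : Vec d) (ω : EuclideanSpace ℝ (ι ⊕ Fin d ⊕ Unit)) :
    affineForm z ω = (∑ i, ω (Sum.inr (Sum.inl i)) * z i) + ω (Sum.inr (Sum.inr ())) := by
  simp [affineForm, mul_comm]

lemma norm_reindex_le {κ : Type*} [Fintype κ] {f : κ → ι} (hf : Function.Injective f)
    (x : EuclideanSpace ℝ ι) : ‖(WithLp.toLp 2 fun k => x (f k) : EuclideanSpace ℝ κ)‖ ≤ ‖x‖ := by
  classical
  rw [← sq_le_sq₀ (norm_nonneg _) (norm_nonneg _), EuclideanSpace.real_norm_sq_eq,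
    EuclideanSpace.real_norm_sq_eq]
  simp only
  rw [← Finset.sum_image (f := fun i => x i ^ 2) (fun a _ b _ h => hf h)]
  exact Finset.sum_le_sum_of_subset_of_nonneg (Finset.subset_univ _) fun i _ _ => sq_nonneg _

lemma abs_coord_le (x : EuclideanSpace ℝ ι) (i : ι) : |x i| ≤ ‖x‖ :=
  PiLp.norm_apply_le x i

lemma abs_weight_le (z : Vec d) (ω : EuclideanSpace ℝ (ι ⊕ Fin d ⊕ Unit)) :
    |∑ i, ω (Sum.inr (Sum.inl i)) * z i| ≤ ‖z‖ * ‖ω‖ := by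
  have h := abs_real_inner_le_norm z
    (WithLp.toLp 2 fun k : Fin d => ω (Sum.inr (Sum.inl k)) : Vec d)
  have h2 := norm_reindex_le (κ := Fin d) (f := fun k => (Sum.inr (Sum.inl k) : ι ⊕ Fin d ⊕ Unit))
    (fun a b h => by simpa using h) ω
  refine le_trans (le_of_eq ?_) (h.trans (mul_le_mul_of_nonneg_left h2 (norm_nonneg _)))
  simp [PiLp.inner_apply]

lemma abs_affineForm_le (z : Vec d) (ω : EuclideanSpace ℝ (ι ⊕ Fin d ⊕ Unit)) :
    |affineForm z ω| ≤ (‖z‖ + 1) * ‖ω‖ := by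
  rw [affineForm_apply]
  refine (abs_add_le _ _).trans ?_
  have := abs_weight_le z ω
  have := abs_coord_le ω (Sum.inr (Sum.inr ()))
  linarith

lemma abs_affineForm_sub_le (z z' : Vec d) (ω : EuclideanSpace ℝ (ι ⊕ Fin d ⊕ Unit)) :
    |affineForm z ω - affineForm z' ω| ≤ ‖z - z'‖ * ‖ω‖ := by
  refine le_trans (le_of_eq ?_) (abs_weight_le (z - z') ω)
  rw [affineForm_apply, affineForm_apply, add_sub_add_right_eq_sub, ← Finset.sum_sub_distrib]
  simp [mul_sub]

end

section
variable {C₁ : ℝ} {σ₀ : ℝ → ℝ}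

lemma IsActivation.nonneg (h : IsActivation C₁ σ₀) : 0 ≤ C₁ :=
  (abs_nonneg _).trans (h.deriv_le 0)

lemma IsActivation.abs_sub_le (h : IsActivation C₁ σ₀) (s t : ℝ) :
    |σ₀ s - σ₀ t| ≤ C₁ * |s - t| :=
  convex_univ.norm_image_sub_le_of_norm_deriv_le (fun x _ => h.differentiable x)
    (fun x _ => h.deriv_le x) (mem_univ _) (mem_univ _)

lemma IsActivation.abs_deriv_sub_le (h : IsActivation C₁ σ₀) (s t : ℝ) :
    |deriv σ₀ s - deriv σ₀ t| ≤ C₁ * |s - t| :=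
  convex_univ.norm_image_sub_le_of_norm_deriv_le (fun x _ => h.differentiable_deriv x)
    (fun x _ => h.deriv2_le x) (mem_univ _) (mem_univ _)

lemma IsActivation.abs_le (h : IsActivation C₁ σ₀) (t : ℝ) : |σ₀ t| ≤ C₁ * (|t| + 1) :=
  (h.growth t).trans (mul_le_mul_of_nonneg_left
    (max_le (by linarith) (by linarith [abs_nonneg t])) h.nonneg)

lemma abs_mul_sub_mul_le (p q p' q' : ℝ) :
    |p * q - p' * q'| ≤ |p - p'| * |q| + |p'| * |q - q'| := by
  rw [show p * q - p' * q' = (p - p') * q + p' * (q - q') by ring, ← abs_mul, ← abs_mul]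
  exact abs_add_le _ _

lemma IsActivation.abs_deriv_mul_sub_le (h : IsActivation C₁ σ₀) (s s' t t' : ℝ) :
    |deriv σ₀ s * deriv σ₀ s' - deriv σ₀ t * deriv σ₀ t'| ≤ C₁ ^ 2 * (|s - t| + |s' - t'|) := by
  have h0 := h.nonneg
  have h1 := mul_le_mul (h.abs_deriv_sub_le s t) (h.deriv_le s') (abs_nonneg _) (by positivity)
  have h2 := mul_le_mul (h.deriv_le t) (h.abs_deriv_sub_le s' t') (abs_nonneg _) h0
  linarith [abs_mul_sub_mul_le (deriv σ₀ s) (deriv σ₀ s') (deriv σ₀ t) (deriv σ₀ t')]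

lemma IsActivation.abs_deriv_mul_le (h : IsActivation C₁ σ₀) (s t : ℝ) :
    |deriv σ₀ s * deriv σ₀ t| ≤ C₁ ^ 2 := by
  rw [abs_mul, pow_two]
  exact mul_le_mul (h.deriv_le s) (h.deriv_le t) (abs_nonneg _) h.nonneg

end

/-! ### The kernel of the Gram matrix of the head -/

/-- The kernel `⟨∇_ω h(z, ω), ∇_ω h(z', ω)⟩`. -/
noncomputable def headKernel {d : ℕ} (σ₀ : ℝ → ℝ) (z z' : Vec d) (ω : HeadParam d) : ℝ :=
  σ₀ (affineForm z ω) * σ₀ (affineForm z' ω) +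
    ω (Sum.inl ()) ^ 2 * (deriv σ₀ (affineForm z ω) * deriv σ₀ (affineForm z' ω)) *
      (inner ℝ z z' + 1)

/-- Local Lipschitz continuity with a constant growing at most quadratically in one of the points
and linearly in the distance. -/
def QuadLip {E F : Type*} [NormedAddCommGroup E] [NormedAddCommGroup F] (L : ℝ) (f : E → F) : Prop :=
  ∀ x y, ‖f x - f y‖ ≤ L * (‖x - y‖ ^ 2 + (1 + ‖y‖) ^ 2 * ‖x - y‖)

section
variable {d : ℕ} {C₁ : ℝ} {σ₀ : ℝ → ℝ}

/-- Products are expanded around `ψ`. The difference of the squared outer weights meets only the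
bounded product of derivatives, and the Lipschitz difference of derivatives meets only `b ^ 2`. The
growth thus stays quadratic, which measures with merely a second moment can integrate. -/
lemma quadLip_headKernel (h : IsActivation C₁ σ₀) {Q : ℝ} {z z' : Vec d} (hz : ‖z‖ + 1 ≤ Q)
    (hz' : ‖z'‖ + 1 ≤ Q) : QuadLip (2 * C₁ ^ 2 * Q ^ 3) (headKernel σ₀ z z') := by
  intro ω ψ
  have hC := h.nonneg
  have hQ1 : 1 ≤ Q := by linarith [norm_nonneg z]
  have hQ : 0 ≤ Q := by linarith
  set δ := ‖ω - ψ‖ with hδ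
  set N := ‖ψ‖ with hN
  have hδ0 : 0 ≤ δ := norm_nonneg _
  have hN0 : 0 ≤ N := norm_nonneg _
  have key : ∀ y : Vec d, ‖y‖ + 1 ≤ Q → |affineForm y ω - affineForm y ψ| ≤ Q * δ ∧
      |affineForm y ψ| ≤ Q * N := fun y hy => by
    refine ⟨?_, (abs_affineForm_le y ψ).trans (mul_le_mul_of_nonneg_right hy hN0)⟩
    rw [← map_sub]
    exact (abs_affineForm_le y _).trans (mul_le_mul_of_nonneg_right hy hδ0)
  obtain ⟨k1, k2⟩ := key z hz
  obtain ⟨k1', k2'⟩ := key z' hz'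
  unfold headKernel
  set s := affineForm z ω
  set s' := affineForm z' ω
  set t := affineForm z ψ
  set t' := affineForm z' ψ
  set a := ω (Sum.inl ())
  set b := ψ (Sum.inl ())
  have hab : |a - b| ≤ δ := abs_coord_le (ω - ψ) (Sum.inl ())
  have hb : |b| ≤ N := abs_coord_le ψ (Sum.inl ())
  have a1 : |σ₀ s - σ₀ t| ≤ C₁ * (Q * δ) :=
    (h.abs_sub_le s t).trans (mul_le_mul_of_nonneg_left k1 hC)
  have a1' : |σ₀ s' - σ₀ t'| ≤ C₁ * (Q * δ) :=
    (h.abs_sub_le s' t').trans (mul_le_mul_of_nonneg_left k1' hC)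
  have a2 : |σ₀ t| ≤ C₁ * (Q * (N + 1)) :=
    (h.abs_le t).trans (mul_le_mul_of_nonneg_left (by linarith) hC)
  have a2' : |σ₀ t'| ≤ C₁ * (Q * (N + 1)) :=
    (h.abs_le t').trans (mul_le_mul_of_nonneg_left (by linarith) hC)
  have e1 : |σ₀ s * σ₀ s' - σ₀ t * σ₀ t'| ≤ C₁ ^ 2 * Q ^ 2 * (δ ^ 2 + 2 * (1 + N) * δ) := by
    have a3 : |σ₀ s'| ≤ C₁ * (Q * (N + 1)) + C₁ * (Q * δ) := by
      have := abs_add_le (σ₀ s' - σ₀ t') (σ₀ t')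
      rw [sub_add_cancel] at this
      linarith
    have b1 := mul_le_mul a1 a3 (abs_nonneg _) (by positivity)
    have b2 := mul_le_mul a2 a1' (abs_nonneg _) (by positivity)
    refine (abs_mul_sub_mul_le _ _ _ _).trans ((add_le_add b1 b2).trans (le_of_eq ?_))
    ring
  have e2 : |a ^ 2 * (deriv σ₀ s * deriv σ₀ s') - b ^ 2 * (deriv σ₀ t * deriv σ₀ t')| ≤
      C₁ ^ 2 * (δ ^ 2 + 2 * N * δ + 2 * N ^ 2 * (Q * δ)) := by
    have c1 : |a ^ 2 - b ^ 2| ≤ δ ^ 2 + 2 * N * δ := by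
      rw [show a ^ 2 - b ^ 2 = (a - b) * ((a - b) + 2 * b) by ring, abs_mul]
      have : |a - b + 2 * b| ≤ δ + 2 * N := by
        refine (abs_add_le _ _).trans (add_le_add hab ?_)
        rw [abs_mul, abs_two]; linarith
      refine (mul_le_mul hab this (abs_nonneg _) hδ0).trans (le_of_eq (by ring))
    have c2 : |b ^ 2| ≤ N ^ 2 := by
      rw [abs_pow]; exact pow_le_pow_left₀ (abs_nonneg _) hb 2
    have c3 := h.abs_deriv_mul_sub_le s s' t t'
    have c4 : |deriv σ₀ s * deriv σ₀ s' - deriv σ₀ t * deriv σ₀ t'| ≤ C₁ ^ 2 * (2 * (Q * δ)) :=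
      c3.trans (mul_le_mul_of_nonneg_left (by linarith) (by positivity))
    have b1 := mul_le_mul c1 (h.abs_deriv_mul_le s s') (abs_nonneg _) (by positivity)
    have b2 := mul_le_mul c2 c4 (abs_nonneg _) (by positivity)
    refine (abs_mul_sub_mul_le _ _ _ _).trans ((add_le_add b1 b2).trans (le_of_eq ?_))
    ring
  have e3 : |inner ℝ z z' + 1| ≤ Q ^ 2 := by
    refine (abs_add_le _ _).trans ?_
    have h1 := abs_real_inner_le_norm z z'
    have h2 : ‖z‖ * ‖z'‖ ≤ (Q - 1) * (Q - 1) :=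
      mul_le_mul (by linarith) (by linarith) (norm_nonneg _) (by linarith)
    rw [abs_one]
    nlinarith
  rw [Real.norm_eq_abs, add_sub_add_comm, ← sub_mul]
  refine (abs_add_le _ _).trans ?_
  rw [abs_mul]
  have e4 := mul_le_mul e2 e3 (abs_nonneg _) (by positivity)
  refine (add_le_add e1 e4).trans ?_
  have hq : Q ^ 2 ≤ Q ^ 3 := pow_le_pow_right₀ hQ1 (by norm_num)
  have f1 : C₁ ^ 2 * Q ^ 2 * (δ ^ 2 + 2 * (1 + N) * δ) ≤
      C₁ ^ 2 * Q ^ 3 * (δ ^ 2 + 2 * (1 + N) * δ) := by gcongr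
  have f2 : C₁ ^ 2 * (δ ^ 2 + 2 * N * δ + 2 * N ^ 2 * (Q * δ)) * Q ^ 2 ≤
      C₁ ^ 2 * Q ^ 3 * (δ ^ 2 + 2 * N * δ + 2 * N ^ 2 * δ) := by
    have : C₁ ^ 2 * Q ^ 2 * (δ ^ 2 + 2 * N * δ) ≤ C₁ ^ 2 * Q ^ 3 * (δ ^ 2 + 2 * N * δ) := by gcongr
    linarith
  refine (add_le_add f1 f2).trans (le_of_eq ?_)
  ring

/-- This is variation in the states instead of the parameters. The factor `a ^ 2` times the change
of `σ₀'` costs cubic growth in `ω`, so the estimate is integrated only against the Gaussian. -/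
lemma abs_headKernel_sub_le (h : IsActivation C₁ σ₀) {Q : ℝ} {z z' x x' : Vec d}
    (hz' : ‖z'‖ + 1 ≤ Q) (hx : ‖x‖ + 1 ≤ Q) (hx' : ‖x'‖ + 1 ≤ Q)
    (ω : HeadParam d) :
    |headKernel σ₀ z z' ω - headKernel σ₀ x x' ω| ≤
      C₁ ^ 2 * Q ^ 2 * (‖z - x‖ + ‖z' - x'‖) * (1 + ‖ω‖) ^ 3 := by
  have hC := h.nonneg
  have hQ1 : 1 ≤ Q := by linarith [norm_nonneg x]
  have hQ : 0 ≤ Q := by linarith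
  have k1 := abs_affineForm_sub_le z x ω
  have k1' := abs_affineForm_sub_le z' x' ω
  have k2 := (abs_affineForm_le x ω).trans (mul_le_mul_of_nonneg_right hx (norm_nonneg _))
  have k2' := (abs_affineForm_le z' ω).trans (mul_le_mul_of_nonneg_right hz' (norm_nonneg _))
  have hin : |inner ℝ z z' - inner ℝ x x'| ≤ Q * (‖z - x‖ + ‖z' - x'‖) := by
    rw [show inner ℝ z z' - inner ℝ x x' = inner ℝ (z - x) z' + inner ℝ x (z' - x') by
      rw [inner_sub_left, inner_sub_right]; ring]
    refine (abs_add_le _ _).trans ?_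
    have h1 := (abs_real_inner_le_norm (z - x) z').trans
      (mul_le_mul_of_nonneg_left (by linarith : ‖z'‖ ≤ Q) (norm_nonneg _))
    have h2 := (abs_real_inner_le_norm x (z' - x')).trans
      (mul_le_mul_of_nonneg_right (by linarith : ‖x‖ ≤ Q) (norm_nonneg _))
    linarith
  have e3 : |inner ℝ x x' + 1| ≤ Q ^ 2 := by
    refine (abs_add_le _ _).trans ?_
    have h1 := abs_real_inner_le_norm x x'
    have h2 : ‖x‖ * ‖x'‖ ≤ (Q - 1) * (Q - 1) :=
      mul_le_mul (by linarith) (by linarith) (norm_nonneg _) (by linarith)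
    rw [abs_one]
    nlinarith
  have ha := abs_coord_le ω (Sum.inl ())
  unfold headKernel
  set N := ‖ω‖ with hN
  have hN0 : 0 ≤ N := norm_nonneg _
  set ε := ‖z - x‖ with hε
  set ε' := ‖z' - x'‖ with hε'
  have hε0 : 0 ≤ ε := norm_nonneg _
  have hε'0 : 0 ≤ ε' := norm_nonneg _
  set s := affineForm z ω
  set s' := affineForm z' ω
  set t := affineForm x ω
  set t' := affineForm x' ω
  set a := ω (Sum.inl ())
  have e1 : |σ₀ s * σ₀ s' - σ₀ t * σ₀ t'| ≤ C₁ ^ 2 * Q * (ε + ε') * (N * (N + 1)) := by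
    have a1 : |σ₀ s - σ₀ t| ≤ C₁ * (ε * N) :=
      (h.abs_sub_le s t).trans (mul_le_mul_of_nonneg_left k1 hC)
    have a1' : |σ₀ s' - σ₀ t'| ≤ C₁ * (ε' * N) :=
      (h.abs_sub_le s' t').trans (mul_le_mul_of_nonneg_left k1' hC)
    have a2 : |σ₀ t| ≤ C₁ * (Q * (N + 1)) :=
      (h.abs_le t).trans (mul_le_mul_of_nonneg_left (by linarith) hC)
    have a2' : |σ₀ s'| ≤ C₁ * (Q * (N + 1)) :=
      (h.abs_le s').trans (mul_le_mul_of_nonneg_left (by linarith) hC)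
    have b1 := mul_le_mul a1 a2' (abs_nonneg _) (by positivity)
    have b2 := mul_le_mul a2 a1' (abs_nonneg _) (by positivity)
    refine (abs_mul_sub_mul_le _ _ _ _).trans ((add_le_add b1 b2).trans (le_of_eq ?_))
    ring
  have hasq : |a ^ 2| ≤ N ^ 2 := by
    rw [abs_pow]; exact pow_le_pow_left₀ (abs_nonneg _) ha 2
  have e2 : |deriv σ₀ s * deriv σ₀ s' * (inner ℝ z z' + 1) -
      deriv σ₀ t * deriv σ₀ t' * (inner ℝ x x' + 1)| ≤
      C₁ ^ 2 * (Q * (ε + ε')) + C₁ ^ 2 * (ε * N + ε' * N) * Q ^ 2 := by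
    have b1 := mul_le_mul (h.abs_deriv_mul_le s s') hin (abs_nonneg _) (by positivity)
    have c1 : |deriv σ₀ s * deriv σ₀ s' - deriv σ₀ t * deriv σ₀ t'| ≤
        C₁ ^ 2 * (ε * N + ε' * N) := (h.abs_deriv_mul_sub_le s s' t t').trans
      (mul_le_mul_of_nonneg_left (by linarith) (by positivity))
    have b2 := mul_le_mul c1 e3 (abs_nonneg _) (by positivity)
    rw [show deriv σ₀ s * deriv σ₀ s' * (inner ℝ z z' + 1) -
      deriv σ₀ t * deriv σ₀ t' * (inner ℝ x x' + 1) =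
      deriv σ₀ s * deriv σ₀ s' * (inner ℝ z z' - inner ℝ x x') +
      (deriv σ₀ s * deriv σ₀ s' - deriv σ₀ t * deriv σ₀ t') * (inner ℝ x x' + 1) by ring]
    refine (abs_add_le _ _).trans ?_
    rw [abs_mul, abs_mul _ (inner ℝ x x' + 1)]
    exact add_le_add b1 b2
  rw [add_sub_add_comm, mul_assoc, mul_assoc (a ^ 2), ← mul_sub]
  refine (abs_add_le _ _).trans ?_
  rw [abs_mul (a ^ 2)]
  refine (add_le_add e1 (mul_le_mul hasq e2 (abs_nonneg _) (by positivity))).trans ?_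
  have hq : Q ≤ Q ^ 2 := by nlinarith
  have f1 : C₁ ^ 2 * Q * (ε + ε') * (N * (N + 1)) ≤
    C₁ ^ 2 * Q ^ 2 * (ε + ε') * (N * (N + 1)) := by gcongr
  have f2 : C₁ ^ 2 * (Q * (ε + ε')) ≤ C₁ ^ 2 * (Q ^ 2 * (ε + ε')) := by gcongr
  calc _ ≤ C₁ ^ 2 * Q ^ 2 * (ε + ε') * (N * (N + 1)) +
        N ^ 2 * (C₁ ^ 2 * (Q ^ 2 * (ε + ε')) + C₁ ^ 2 * (ε * N + ε' * N) * Q ^ 2) := by gcongr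
    _ = C₁ ^ 2 * Q ^ 2 * (ε + ε') * (N * (N + 1) + N ^ 2 + N ^ 3) := by ring
    _ ≤ _ := by
      gcongr
      nlinarith [pow_nonneg hN0 2, pow_nonneg hN0 3]

lemma resBlock_eq (z : Vec d) (θ : ResParam d) : resBlock σ₀ z θ =
    σ₀ (affineForm z θ) • (WithLp.toLp 2 fun k => θ (Sum.inl k) : Vec d) := by
  ext k
  simp [resBlock, affineForm_apply, mul_comm]

lemma quadLip_resBlock (h : IsActivation C₁ σ₀) (z : Vec d) :
    QuadLip (2 * C₁ * (‖z‖ + 1)) (resBlock σ₀ z) := by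
  intro ω ψ
  have hC := h.nonneg
  have hQ : 1 ≤ ‖z‖ + 1 := by linarith [norm_nonneg z]
  rw [resBlock_eq, resBlock_eq]
  have hinj : Function.Injective (fun k => (Sum.inl k : ResIdx d)) := Sum.inl_injective
  have h1 := norm_reindex_le hinj ψ
  have h2 := norm_reindex_le hinj (ω - ψ)
  have h3 := abs_affineForm_le z (ω - ψ)
  have h4 := abs_affineForm_le z ψ
  set Q := ‖z‖ + 1
  set δ := ‖ω - ψ‖ with hδ
  set N := ‖ψ‖ with hN
  have hδ0 : 0 ≤ δ := norm_nonneg _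
  have hN0 : 0 ≤ N := norm_nonneg _
  have h5 : (WithLp.toLp 2 fun k => (ω - ψ) (Sum.inl k) : Vec d) =
    (WithLp.toLp 2 fun k => ω (Sum.inl k) : Vec d) - (WithLp.toLp 2 fun k => ψ (Sum.inl k) : Vec d) :=
    rfl
  rw [h5] at h2
  set u := (WithLp.toLp 2 fun k => ω (Sum.inl k) : Vec d)
  set v := (WithLp.toLp 2 fun k => ψ (Sum.inl k) : Vec d)
  rw [map_sub] at h3
  set s := affineForm z ω
  set t := affineForm z ψ
  have a1 : |σ₀ s - σ₀ t| ≤ C₁ * (Q * δ) :=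
    (h.abs_sub_le s t).trans (mul_le_mul_of_nonneg_left h3 hC)
  have a2 : |σ₀ t| ≤ C₁ * (Q * (N + 1)) :=
    (h.abs_le t).trans (mul_le_mul_of_nonneg_left (by linarith) hC)
  have hu : ‖u‖ ≤ δ + N := by
    have := norm_add_le (u - v) v
    rw [sub_add_cancel] at this
    linarith
  rw [show σ₀ s • u - σ₀ t • v = (σ₀ s - σ₀ t) • u + σ₀ t • (u - v) by
    rw [sub_smul, smul_sub]; abel]
  refine (norm_add_le _ _).trans ?_
  rw [norm_smul, norm_smul, Real.norm_eq_abs, Real.norm_eq_abs]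
  have b1 := mul_le_mul a1 hu (norm_nonneg _) (by positivity)
  have b2 := mul_le_mul a2 h2 (norm_nonneg _) (by positivity)
  refine (add_le_add b1 b2).trans ?_
  calc _ = C₁ * Q * (δ ^ 2 + (1 + 2 * N) * δ) := by ring
    _ ≤ C₁ * Q * (2 * (δ ^ 2 + (1 + N) ^ 2 * δ)) := by
      gcongr
      nlinarith [mul_nonneg (sq_nonneg N) hδ0, sq_nonneg δ, mul_nonneg hN0 hδ0]
    _ = _ := by ring

end

/-! ### Integrals of locally Lipschitz functions and the Wasserstein distance -/

section
variable {E F : Type*} [NormedAddCommGroup E] [NormedAddCommGroup F] {L : ℝ} {f : E → F}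

lemma QuadLip.continuous (hf : QuadLip L f) : Continuous f := by
  refine continuous_iff_continuousAt.2 fun y => tendsto_iff_norm_sub_tendsto_zero.2 ?_
  refine squeeze_zero (fun _ => norm_nonneg _) (fun x => hf x y) ?_
  have : Continuous fun x : E => L * (‖x - y‖ ^ 2 + (1 + ‖y‖) ^ 2 * ‖x - y‖) := by fun_prop
  simpa using this.tendsto y

variable [MeasurableSpace E] [BorelSpace E] [SecondCountableTopology E]

omit [BorelSpace E] [SecondCountableTopology E] in
lemma IsP2.integrable_norm_sq {μ : Measure E} (hμ : IsP2 μ) : Integrable (fun x => ‖x‖ ^ 2) μ :=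
  hμ.2.integrable_norm_pow (by norm_num)

lemma QuadLip.integrable (hf : QuadLip L f) {μ : Measure E} (hμ : IsP2 μ) : Integrable f μ := by
  have := hμ.1
  have h1 : Integrable (fun x => ‖x‖) μ := (hμ.2.integrable (by norm_num)).norm
  refine Integrable.mono' (g := fun x => ‖f 0‖ + L * (‖x‖ ^ 2 + ‖x‖))
    ((integrable_const _).add ((hμ.integrable_norm_sq.add h1).const_mul L))
    hf.continuous.aestronglyMeasurable (ae_of_all _ fun x => ?_)
  have h2 := hf x 0
  have h3 := norm_add_le (f x - f 0) (f 0)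
  rw [sub_add_cancel] at h3
  simp only [sub_zero, norm_zero, add_zero, one_pow, one_mul] at h2
  linarith

variable [NormedSpace ℝ F]

/-- The cross term is split by Young's inequality with weight `c`, the bound on the transport cost.
Both pieces then scale at least linearly in `c`, and the fourth moment is required of `ν` only,
later the Gaussian. -/
lemma QuadLip.norm_integral_sub_le_of_coupling (hf : QuadLip L f) (hL : 0 ≤ L) {μ ν : Measure E}
    (hμ : IsP2 μ) (hν : IsP2 ν) (hν4 : Integrable (fun x => (1 + ‖x‖) ^ 4) ν)
    {π : Measure (E × E)} (hπ : IsCoupling μ ν π) {c : ℝ} (hc : 0 < c)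
    (hcost : ∫⁻ p, ‖p.1 - p.2‖ₑ ^ 2 ∂π ≤ ENNReal.ofReal (c ^ 2)) :
    ‖∫ x, f x ∂μ - ∫ x, f x ∂ν‖ ≤ L * (c ^ 2 + c * (1 + ∫ x, (1 + ‖x‖) ^ 4 ∂ν) / 2) := by
  obtain ⟨h1, h2⟩ := hπ
  have i1 : Integrable (fun p : E × E => f p.1) π :=
    (h1 ▸ hf.integrable hμ : Integrable f (π.map Prod.fst)).comp_measurable measurable_fst
  have i2 : Integrable (fun p : E × E => f p.2) π :=
    (h2 ▸ hf.integrable hν : Integrable f (π.map Prod.snd)).comp_measurable measurable_snd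
  have i4 : Integrable (fun p : E × E => (1 + ‖p.2‖) ^ 4) π :=
    (h2 ▸ hν4 : Integrable (fun x : E => (1 + ‖x‖) ^ 4) (π.map Prod.snd)).comp_measurable
      measurable_snd
  have e1 : ∫ x, f x ∂μ = ∫ p, f p.1 ∂π := by
    rw [← h1, integral_map measurable_fst.aemeasurable hf.continuous.aestronglyMeasurable]
  have e2 : ∫ x, f x ∂ν = ∫ p, f p.2 ∂π := by
    rw [← h2, integral_map measurable_snd.aemeasurable hf.continuous.aestronglyMeasurable]
  have e4 : ∫ x, (1 + ‖x‖) ^ 4 ∂ν = ∫ p, (1 + ‖p.2‖) ^ 4 ∂π := by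
    rw [← h2, integral_map measurable_snd.aemeasurable]
    exact Continuous.aestronglyMeasurable (by fun_prop)
  have henn : ∀ p : E × E, ‖p.1 - p.2‖ₑ ^ 2 = ENNReal.ofReal (‖p.1 - p.2‖ ^ 2) := fun p => by
    rw [ENNReal.ofReal_pow (norm_nonneg _), ofReal_norm]
  simp_rw [henn] at hcost
  have hms : AEStronglyMeasurable (fun p : E × E => ‖p.1 - p.2‖ ^ 2) π :=
    Continuous.aestronglyMeasurable (by fun_prop)
  have i3 : Integrable (fun p : E × E => ‖p.1 - p.2‖ ^ 2) π := by
    refine ⟨hms, ?_⟩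
    rw [hasFiniteIntegral_iff_ofReal (ae_of_all _ fun p => by positivity)]
    exact hcost.trans_lt ENNReal.ofReal_lt_top
  have hcost' : ∫ p, ‖p.1 - p.2‖ ^ 2 ∂π ≤ c ^ 2 := by
    rw [integral_eq_lintegral_of_nonneg_ae (ae_of_all _ fun p => by positivity) hms]
    exact ENNReal.toReal_le_of_le_ofReal (by positivity) hcost
  rw [e1, e2, e4, ← integral_sub i1 i2]
  have ib : Integrable (fun p : E × E => L * ((1 + 1 / (2 * c)) * ‖p.1 - p.2‖ ^ 2 +
      c / 2 * (1 + ‖p.2‖) ^ 4)) π := ((i3.const_mul _).add (i4.const_mul _)).const_mul L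
  refine (norm_integral_le_of_norm_le ib (ae_of_all _ fun p => (hf p.1 p.2).trans ?_)).trans ?_
  · refine mul_le_mul_of_nonneg_left ?_ hL
    have h : (1 + ‖p.2‖) ^ 2 * ‖p.1 - p.2‖ ≤
        1 / (2 * c) * ‖p.1 - p.2‖ ^ 2 + c / 2 * (1 + ‖p.2‖) ^ 4 := by
      have : 1 / (2 * c) * ‖p.1 - p.2‖ ^ 2 + c / 2 * (1 + ‖p.2‖) ^ 4 -
          (1 + ‖p.2‖) ^ 2 * ‖p.1 - p.2‖ =
          1 / (2 * c) * (‖p.1 - p.2‖ - c * (1 + ‖p.2‖) ^ 2) ^ 2 := by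
        field_simp
        ring
      have h0 : 0 ≤ 1 / (2 * c) * (‖p.1 - p.2‖ - c * (1 + ‖p.2‖) ^ 2) ^ 2 := by positivity
      linarith
    linarith
  · rw [integral_const_mul, integral_add (i3.const_mul _) (i4.const_mul _), integral_const_mul,
      integral_const_mul]
    refine mul_le_mul_of_nonneg_left ?_ hL
    have : (1 + 1 / (2 * c)) * ∫ p, ‖p.1 - p.2‖ ^ 2 ∂π ≤ (1 + 1 / (2 * c)) * c ^ 2 := by gcongr
    have h' : (1 + 1 / (2 * c)) * c ^ 2 = c ^ 2 + c / 2 := by field_simp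
    linarith

lemma exists_coupling_of_W2_lt {E : Type*} [NormedAddCommGroup E] [MeasurableSpace E]
    {μ ν : Measure E} {c : ℝ} (hc : 0 ≤ c) (h : W2 μ ν < ENNReal.ofReal c) :
    ∃ π, IsCoupling μ ν π ∧ ∫⁻ p, ‖p.1 - p.2‖ₑ ^ 2 ∂π ≤ ENNReal.ofReal (c ^ 2) := by
  have h2 : (⨅ (π : Measure (E × E)) (_ : IsCoupling μ ν π), ∫⁻ p, ‖p.1 - p.2‖ₑ ^ 2 ∂π) <
      ENNReal.ofReal (c ^ 2) := by
    have := ENNReal.rpow_lt_rpow h (z := 2) (by norm_num)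
    rw [W2, ← ENNReal.rpow_mul] at this
    norm_num at this
    rwa [← ENNReal.ofReal_pow hc] at this
  obtain ⟨π, hπ⟩ := iInf_lt_iff.1 h2
  obtain ⟨h3, h4⟩ := iInf_lt_iff.1 hπ
  exact ⟨π, h3, h4.le⟩

lemma QuadLip.norm_integral_sub_le (hf : QuadLip L f) (hL : 0 ≤ L) {μ ν : Measure E}
    (hμ : IsP2 μ) (hν : IsP2 ν) (hν4 : Integrable (fun x => (1 + ‖x‖) ^ 4) ν)
    {r : ℝ} (hr : 0 ≤ r) (h : W2 μ ν ≤ ENNReal.ofReal r) :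
    ‖∫ x, f x ∂μ - ∫ x, f x ∂ν‖ ≤ L * (r ^ 2 + r * (1 + ∫ x, (1 + ‖x‖) ^ 4 ∂ν) / 2) := by
  have hcont : Continuous fun c : ℝ => L * (c ^ 2 + c * (1 + ∫ x, (1 + ‖x‖) ^ 4 ∂ν) / 2) := by
    fun_prop
  -- The infimum over couplings need not be attained and `r` may be zero, so the bound is proved for
  -- every `c > r` and passed to the limit.
  refine ge_of_tendsto (hcont.continuousWithinAt (s := Ioi r) (x := r)).tendsto ?_
  filter_upwards [self_mem_nhdsWithin] with c hc
  have hc0 : 0 < c := hr.trans_lt hc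
  obtain ⟨π, h1, h2⟩ := exists_coupling_of_W2_lt hc0.le
    (h.trans_lt ((ENNReal.ofReal_lt_ofReal_iff hc0).2 hc))
  exact hf.norm_integral_sub_le_of_coupling hL hμ hν hν4 h1 hc0 h2

end

/-! ### The standard Gaussian -/

section
variable {E : Type*} [NormedAddCommGroup E] [InnerProductSpace ℝ E] [FiniteDimensional ℝ E]
  [MeasurableSpace E] [BorelSpace E]

lemma isP2_stdGaussian : IsP2 (stdGaussian E) :=
  ⟨inferInstance, IsGaussian.memLp_two_id⟩

lemma integrable_one_add_norm_pow_stdGaussian (k : ℕ) :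
    Integrable (fun x => (1 + ‖x‖) ^ k) (stdGaussian E) := by
  have h0 : MemLp (fun x : E => ‖x‖) (k : ENNReal) (stdGaussian E) :=
    (IsGaussian.memLp_id (stdGaussian E) (k : ENNReal) (ENNReal.natCast_ne_top k)).norm
  have h : MemLp (fun x : E => 1 + ‖x‖) (k : ENNReal) (stdGaussian E) := by
    have h1 : MemLp (fun _ : E => (1 : ℝ)) (k : ENNReal) (stdGaussian E) := memLp_const 1
    exact h1.add h0
  refine (h.integrable_norm_pow').congr (ae_of_all _ fun x => ?_)
  simp only [Real.norm_eq_abs]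
  rw [abs_of_nonneg (by positivity)]

/-- The Gaussian is invariant under linear isometries. The change of variables works for arbitrary
`f`, so neither measurability nor integrability has to be checked. -/
lemma integral_stdGaussian_eq_zero_of_odd {F : Type*} [NormedAddCommGroup F] [NormedSpace ℝ F]
    (T : E ≃ₗᵢ[ℝ] E) {f : E → F} (hf : ∀ x, f (T x) = -f x) : ∫ x, f x ∂(stdGaussian E) = 0 := by
  have h : ∫ x, f x ∂(stdGaussian E) = ∫ x, f (T x) ∂(stdGaussian E) := by
    conv_lhs => rw [← stdGaussian_map T]
    exact T.toHomeomorph.toMeasurableEquiv.measurableEmbedding.integral_map _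
  simp_rw [hf, integral_neg] at h
  have h2 : (2 : ℝ) • ∫ x, f x ∂(stdGaussian E) = 0 := by
    rw [two_smul, add_eq_zero_iff_eq_neg]
    exact h
  exact (smul_eq_zero.1 h2).resolve_left two_ne_zero

end

section
variable {ι κ : Type*} [Fintype ι] [Fintype κ]

/-- The isometry changing the sign of the first block of coordinates. -/
noncomputable def negLeft : EuclideanSpace ℝ (ι ⊕ κ) ≃ₗᵢ[ℝ] EuclideanSpace ℝ (ι ⊕ κ) :=
  LinearIsometryEquiv.piLpCongrRight 2 fun i =>
    Sum.rec (fun _ => LinearIsometryEquiv.neg ℝ) (fun _ => LinearIsometryEquiv.refl ℝ ℝ) i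

@[simp] lemma negLeft_inl (x : EuclideanSpace ℝ (ι ⊕ κ)) (i : ι) :
    negLeft x (Sum.inl i) = -x (Sum.inl i) := by
  simp [negLeft]

@[simp] lemma negLeft_inr (x : EuclideanSpace ℝ (ι ⊕ κ)) (i : κ) :
    negLeft x (Sum.inr i) = x (Sum.inr i) := by
  simp [negLeft]

/-- Lebesgue measure is absolutely continuous with respect to the one-dimensional Gaussian;
positivity on open sets passes to products and to continuous surjective images. -/
instance isOpenPosMeasure_stdGaussian :
    (stdGaussian (EuclideanSpace ℝ ι)).IsOpenPosMeasure := by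
  have : (gaussianReal 0 1).IsOpenPosMeasure :=
    (gaussianReal_absolutelyContinuous' 0 one_ne_zero).isOpenPosMeasure
  rw [← map_pi_eq_stdGaussian]
  exact Continuous.isOpenPosMeasure_map (by fun_prop) (WithLp.toLp_surjective 2)

end

/-! ### The forward and adjoint equations -/

section
variable {d : ℕ} {σ₀ : ℝ → ℝ} {α : ℝ}

/-- The Grönwall bound is `2 (exp (K s) - 1)`, and `1 - exp (-K) ≤ K` makes it linear in `K`. This
is what later gives a displacement linear in the Wasserstein distance. -/
lemma gronwallBound_zero_le {K s : ℝ} (hK : 0 ≤ K) (hs : s ≤ 1) :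
    gronwallBound 0 K (2 * K) s ≤ 2 * K * Real.exp K := by
  rcases hK.eq_or_lt with rfl | hK'
  · simp [gronwallBound_K0]
  · simp only [gronwallBound_of_K_ne_0 hK'.ne', zero_mul, zero_add, mul_div_assoc,
      div_self hK'.ne']
    have h1 : Real.exp (K * s) ≤ Real.exp K := Real.exp_le_exp.2 (by nlinarith)
    have h2 := Real.add_one_le_exp (-K)
    have h3 : Real.exp (-K) * Real.exp K = 1 := by rw [← Real.exp_add]; simp
    nlinarith [Real.exp_pos K]

/-- Grönwall's inequality is applied to `z - x`, whose derivative is at most `α k (‖z - x‖ + 2)`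
because `‖x‖ = 1`. If there is no solution, the placeholder `x` satisfies the bound trivially. -/
lemma norm_Z_sub_le {ν : ℝ → Measure (ResParam d)} (hα : 0 ≤ α) {k : ℝ} (hk : 0 ≤ k)
    (hν : ∀ s ∈ Icc (0 : ℝ) 1, ∀ z, ‖∫ θ, resBlock σ₀ z θ ∂(ν s)‖ ≤ k * (‖z‖ + 1))
    {x : Vec d} (hx : ‖x‖ = 1) {s : ℝ} (hs : s ∈ Icc (0 : ℝ) 1) :
    ‖Z α σ₀ ν x s - x‖ ≤ 2 * (α * k) * Real.exp (α * k) := by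
  have hK : 0 ≤ α * k := mul_nonneg hα hk
  unfold Z
  split_ifs with h
  · obtain ⟨h0, h1⟩ := h.choose_spec
    set z := h.choose
    refine le_trans ?_ (gronwallBound_zero_le hK hs.2)
    have := norm_le_gronwallBound_of_norm_deriv_right_le (f := fun t => z t - x)
      (f' := fun t => α • ∫ θ, resBlock σ₀ (z t) θ ∂(ν t)) (δ := 0) (K := α * k)
      (ε := 2 * (α * k)) (a := 0) (b := 1)
      (fun t ht => ((h1 t ht).continuousWithinAt).sub continuousWithinAt_const)
      (fun t ht => ((h1 t ⟨ht.1, ht.2.le⟩).sub_const x).mono_of_mem_nhdsWithin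
        (Icc_mem_nhdsGE_of_mem ht)) (by simp [h0]) (fun t ht => ?_) s hs
    · simpa using this
    · rw [norm_smul, Real.norm_of_nonneg hα]
      have h2 := mul_le_mul_of_nonneg_left (hν t ⟨ht.1, ht.2.le⟩ (z t)) hα
      have h3 : ‖z t‖ ≤ ‖z t - x‖ + 1 := by
        have := norm_add_le (z t - x) x
        rwa [sub_add_cancel, hx] at this
      have h4 := mul_le_mul_of_nonneg_left h3 hK
      linarith
  · simp only [sub_self, norm_zero]
    positivity

lemma resBlock_negLeft (z : Vec d) (θ : ResParam d) :
    resBlock σ₀ z (negLeft θ) = -resBlock σ₀ z θ := by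
  ext k
  simp [resBlock]

lemma head_negLeft (z : Vec d) (ω : HeadParam d) :
    head σ₀ z (negLeft ω) = -head σ₀ z ω := by
  simp [head]

lemma integral_resBlock_nu0 (z : Vec d) (s : ℝ) : ∫ θ, resBlock σ₀ z θ ∂(nu0 d s) = 0 :=
  integral_stdGaussian_eq_zero_of_odd negLeft (resBlock_negLeft z)

lemma integral_fderiv_resBlock_nu0 (z : Vec d) (s : ℝ) :
    ∫ θ, fderiv ℝ (fun z => resBlock σ₀ z θ) z ∂(nu0 d s) = 0 := by
  refine integral_stdGaussian_eq_zero_of_odd negLeft fun θ => ?_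
  simp_rw [resBlock_negLeft]
  exact fderiv_fun_neg

lemma integral_gradient_head_tau0 (z : Vec d) :
    ∫ ω, gradient (fun z => head σ₀ z ω) z ∂(tau0 d) = 0 := by
  refine integral_stdGaussian_eq_zero_of_odd negLeft fun θ => ?_
  simp_rw [head_negLeft, gradient]
  rw [fderiv_fun_neg, map_neg]

lemma Z_nu0 (hα : 0 ≤ α) {x : Vec d} (hx : ‖x‖ = 1) {s : ℝ} (hs : s ∈ Icc (0 : ℝ) 1) :
    Z α σ₀ (nu0 d) x s = x := by
  have := norm_Z_sub_le (σ₀ := σ₀) (ν := nu0 d) hα le_rfl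
    (fun s _ z => by rw [integral_resBlock_nu0]; simp) hx hs
  simpa [sub_eq_zero] using this

/-- The averaged Jacobian of the residual block vanishes, so the adjoint is constant in `s`; its
terminal value is zero by the same symmetry. -/
lemma P_tau0_nu0 (x : Vec d) {s : ℝ} (hs : s ∈ Icc (0 : ℝ) 1) :
    P α σ₀ (tau0 d) (nu0 d) x s = 0 := by
  unfold P
  split_ifs with h
  · obtain ⟨h0, h1⟩ := h.choose_spec
    set p := h.choose
    rw [integral_gradient_head_tau0] at h0
    simp_rw [integral_fderiv_resBlock_nu0] at h1
    have hc := constant_of_has_deriv_right_zero (f := p) (a := 0) (b := 1)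
      (fun t ht => (h1 t ht).continuousWithinAt)
      (fun t (ht : t ∈ Ico (0 : ℝ) 1) => by
        simpa using (h1 t ⟨ht.1, ht.2.le⟩).mono_of_mem_nhdsWithin (Icc_mem_nhdsGE_of_mem ht))
    rw [hc s hs, ← hc 1 ⟨zero_le_one, le_rfl⟩, h0]
  · rfl

lemma G1_tau0_nu0 {n : ℕ} (x : Fin n → Vec d) : G1 α σ₀ x (tau0 d) (nu0 d) = 0 := by
  ext i j
  simp only [G1, Matrix.of_apply, Matrix.zero_apply]
  rw [intervalIntegral.integral_congr (g := fun _ => 0), intervalIntegral.integral_zero]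
  intro s hs
  rw [uIcc_of_le zero_le_one] at hs
  simp [Matrix.mul_apply, J1, P_tau0_nu0 _ hs]

lemma G_tau0_nu0 {n : ℕ} (x : Fin n → Vec d) :
    G α σ₀ x (tau0 d) (nu0 d) = G2 α σ₀ x (tau0 d) (nu0 d) := by
  rw [G, G1_tau0_nu0, smul_zero, zero_add]

/-! ### The Gram matrix of the head in terms of its kernel -/

lemma head_eq (z : Vec d) (ω : HeadParam d) :
    head σ₀ z ω = ω (Sum.inl ()) * σ₀ (affineForm z ω) := by
  rw [head, affineForm_apply]

lemma gradient_head (hσ : Differentiable ℝ σ₀) (z : Vec d) (ω : HeadParam d) :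
    gradient (head σ₀ z) ω = WithLp.toLp 2 (Sum.elim (fun _ => σ₀ (affineForm z ω))
      (Sum.elim (fun i => ω (Sum.inl ()) * deriv σ₀ (affineForm z ω) * z i)
        fun _ => ω (Sum.inl ()) * deriv σ₀ (affineForm z ω))) := by
  refine HasGradientAt.gradient ?_
  rw [hasGradientAt_iff_hasFDerivAt]
  have h1 : HasFDerivAt (fun ω : HeadParam d => ω (Sum.inl ()))
      (EuclideanSpace.proj (Sum.inl ()) : HeadParam d →L[ℝ] ℝ) ω :=
    (EuclideanSpace.proj (Sum.inl ()) : HeadParam d →L[ℝ] ℝ).hasFDerivAt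
  have h2 : HasFDerivAt (fun ω : HeadParam d => σ₀ (affineForm z ω))
      (deriv σ₀ (affineForm z ω) • affineForm z) ω :=
    (hσ (affineForm z ω)).hasDerivAt.comp_hasFDerivAt ω (affineForm z).hasFDerivAt
  have h4 : head σ₀ z = fun ω : HeadParam d => ω (Sum.inl ()) * σ₀ (affineForm z ω) :=
    funext (head_eq z)
  rw [h4]
  refine (h1.mul h2).congr_fderiv ?_
  ext v
  generalize deriv σ₀ (affineForm z ω) = p
  generalize σ₀ (affineForm z ω) = q
  simp only [InnerProductSpace.toDual_apply_apply, PiLp.inner_apply, Fintype.sum_sum_type,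
    Sum.elim_inl, Sum.elim_inr, affineForm_apply, add_apply, FunLike.coe_smul, Pi.smul_apply,
    smul_eq_mul, PiLp.proj_apply, Finset.univ_unique, Finset.sum_singleton,
    PUnit.default_eq_unit, RCLike.inner_apply, conj_trivial]
  rw [mul_add, mul_add, Finset.mul_sum, Finset.mul_sum]
  have : ∀ i, v (Sum.inr (Sum.inl i)) * (ω (Sum.inl ()) * p * z i) =
    ω (Sum.inl ()) * (p * (v (Sum.inr (Sum.inl i)) * z i)) := fun i => by ring
  simp_rw [this]
  ring

lemma headKernel_eq_inner (hσ : Differentiable ℝ σ₀) (z z' : Vec d) (ω : HeadParam d) :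
    headKernel σ₀ z z' ω = inner ℝ (gradient (head σ₀ z) ω) (gradient (head σ₀ z') ω) := by
  simp only [gradient_head hσ, Fintype.sum_sum_type, Sum.elim_inl, Sum.elim_inr,
    Finset.univ_unique, Finset.sum_singleton, headKernel, PiLp.inner_apply, RCLike.inner_apply,
    conj_trivial]
  rw [mul_add, mul_one, Finset.mul_sum]
  congr 1
  · ring
  · congr 1
    · exact Finset.sum_congr rfl fun k _ => by ring
    · ring

lemma G2_apply {n : ℕ} (hσ : Differentiable ℝ σ₀) (x : Fin n → Vec d) (τ : Measure (HeadParam d))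
    (ν : ℝ → Measure (ResParam d)) (i j : Fin n) :
    G2 α σ₀ x τ ν i j =
      ∫ ω, headKernel σ₀ (Z α σ₀ ν (x i) 1) (Z α σ₀ ν (x j) 1) ω ∂τ := by
  simp only [G2, Matrix.of_apply, headKernel_eq_inner hσ, Matrix.mul_apply,
    Matrix.transpose_apply, J2, PiLp.inner_apply, RCLike.inner_apply, conj_trivial]
  simp_rw [mul_comm]

lemma G2_isHermitian {n : ℕ} (x : Fin n → Vec d) (τ : Measure (HeadParam d))
    (ν : ℝ → Measure (ResParam d)) : (G2 α σ₀ x τ ν).IsHermitian := by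
  ext i j
  simp only [Matrix.conjTranspose_apply, star_trivial, G2, Matrix.of_apply, Matrix.mul_apply,
    Matrix.transpose_apply]
  simp_rw [mul_comm]

end

/-! ### The smallest eigenvalue -/

open scoped MatrixOrder in
-- Subtracting `c` shifts the spectrum by `c`, and a Hermitian matrix is positive semidefinite
-- exactly when its spectrum is nonnegative. Positivity of `n` makes the spectrum nonempty, so that
-- its `sInf` is a true minimum.
lemma le_lambdaMin_iff {n : ℕ} (hn : 0 < n) {A : Matrix (Fin n) (Fin n) ℝ} (hA : A.IsHermitian)
    {c : ℝ} : c ≤ lambdaMin A ↔ ∀ v : Fin n → ℝ, c * ∑ i, v i ^ 2 ≤ ∑ i, ∑ j, v i * v j * A i j := by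
  have hne : Nonempty (Fin n) := ⟨⟨0, hn⟩⟩
  have hfin : (spectrum ℝ A).Finite := A.finite_real_spectrum
  have hnon : (spectrum ℝ A).Nonempty := by
    rw [hA.spectrum_real_eq_range_eigenvalues]; exact range_nonempty _
  have h1 : c ≤ lambdaMin A ↔ ∀ t ∈ spectrum ℝ A, c ≤ t := by
    rw [lambdaMin, le_csInf_iff hfin.bddBelow hnon]
  have hH : (A - algebraMap ℝ _ c).IsHermitian := by
    refine hA.sub ?_
    rw [Matrix.algebraMap_eq_diagonal]
    exact Matrix.isHermitian_diagonal _
  have h2 : (∀ t ∈ spectrum ℝ A, c ≤ t) ↔ (A - algebraMap ℝ _ c).PosSemidef := by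
    rw [Matrix.posSemidef_iff_isHermitian_and_spectrum_nonneg]
    simp only [hH, true_and]
    rw [← spectrum.sub_singleton_eq]
    simp [Set.subset_def]
  have hq : ∀ v : Fin n → ℝ, dotProduct v ((A - algebraMap ℝ _ c).mulVec v) =
      ∑ i, ∑ j, v i * v j * A i j - c * ∑ i, v i ^ 2 := fun v => by
    rw [Matrix.sub_mulVec, dotProduct_sub, Matrix.algebraMap_eq_diagonal]
    simp only [dotProduct, Matrix.mulVec, Finset.mul_sum, Matrix.diagonal_apply]
    congr 1
    · exact Finset.sum_congr rfl fun i _ => Finset.sum_congr rfl fun j _ => by ring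
    · refine Finset.sum_congr rfl fun i _ => ?_
      simp
      ring
  rw [h1, h2, Matrix.posSemidef_iff_dotProduct_mulVec]
  simp only [hH, true_and, star_trivial]
  exact forall_congr' fun v => by rw [hq, sub_nonneg]

/-- The quadratic forms differ by at most `ε (∑ |vᵢ|)²`, and Cauchy–Schwarz turns this into `n ε ∑
vᵢ²`. -/
lemma lambdaMin_sub_le {n : ℕ} (hn : 0 < n) {A B : Matrix (Fin n) (Fin n) ℝ} (hA : A.IsHermitian)
    (hB : B.IsHermitian) {ε : ℝ} (h : ∀ i j, |B i j - A i j| ≤ ε) :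
    lambdaMin A - n * ε ≤ lambdaMin B := by
  have hε : 0 ≤ ε := (abs_nonneg _).trans (h ⟨0, hn⟩ ⟨0, hn⟩)
  rw [le_lambdaMin_iff hn hB]
  intro v
  have h1 := (le_lambdaMin_iff hn hA).1 le_rfl v
  have h2 : ∑ i, ∑ j, v i * v j * A i j - ∑ i, ∑ j, v i * v j * B i j ≤
      ε * (∑ i, |v i|) ^ 2 := by
    rw [pow_two, Finset.sum_mul_sum, Finset.mul_sum, ← Finset.sum_sub_distrib]
    refine Finset.sum_le_sum fun i _ => ?_
    rw [Finset.mul_sum, ← Finset.sum_sub_distrib]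
    refine Finset.sum_le_sum fun j _ => ?_
    rw [← mul_sub]
    refine (le_abs_self _).trans ?_
    rw [abs_mul, abs_mul, abs_sub_comm, mul_comm ε]
    exact mul_le_mul_of_nonneg_left (h i j) (by positivity)
  have h3 : (∑ i, |v i|) ^ 2 ≤ n * ∑ i, v i ^ 2 := by
    simpa using sq_sum_le_card_mul_sum_sq (s := Finset.univ) (f := fun i => |v i|)
  have h4 := mul_le_mul_of_nonneg_left h3 hε
  linarith

/-! ### Linear independence of ridge functions -/

/-- Constant differences make `g` affine along the multiples of `t`, and boundedness kills the
slope. -/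
lemma eq_of_forall_difference_const {g : ℝ → ℝ} {B : ℝ} (hB : ∀ t, |g t| ≤ B)
    (h : ∀ δ, ∃ c, ∀ t, g (t + δ) - g t = c) (t : ℝ) : g t = g 0 := by
  obtain ⟨c, hc⟩ := h t
  have h1 : ∀ k : ℕ, g (k * t) = g 0 + k * c := fun k => by
    induction k with
    | zero => simp
    | succ k ih =>
      have := hc (k * t)
      push_cast
      rw [add_one_mul, add_one_mul]
      linarith
  have h2 : c = 0 := by
    by_contra hne
    obtain ⟨k, hk⟩ := exists_nat_gt (2 * B / |c|)
    rw [div_lt_iff₀ (abs_pos.2 hne)] at hk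
    have h3 : |(k : ℝ) * c| ≤ 2 * B := by
      rw [show (k : ℝ) * c = g (k * t) - g 0 by rw [h1]; ring]
      exact (abs_sub _ _).trans (by linarith [hB (k * t), hB 0])
    rw [abs_mul, Nat.abs_cast] at h3
    linarith
  have := hc 0
  rw [zero_add, h2] at this
  linarith

/-- Induction by finite differences. Translating `(w, b)` by `(e, -⟨e, x j⟩)` leaves the argument of
the `j`-th ridge unchanged, so subtracting the two relations eliminates it. The induction hypothesis
says that the differences of the remaining functions are constant, and boundedness makes the
functions themselves constant. -/
lemma ridge_const {ι V : Type*} [NormedAddCommGroup V] [InnerProductSpace ℝ V] {x : ι → V}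
    (hx : Function.Injective x) (s : Finset ι) (g : ι → ℝ → ℝ) (hg : ∀ i, ∃ B, ∀ t, |g i t| ≤ B)
    (h : ∀ w b, ∑ i ∈ s, g i (inner ℝ w (x i) + b) = 0) : ∀ i ∈ s, ∀ t, g i t = g i 0 := by
  classical
  induction s using Finset.induction_on generalizing g with
  | empty => simp
  | insert j s hj ih =>
    simp only [Finset.sum_insert hj] at h
    have hs : ∀ i ∈ s, ∀ t, g i t = g i 0 := by
      intro i hi
      obtain ⟨B, hB⟩ := hg i
      refine eq_of_forall_difference_const hB fun δ => ?_
      have hne : x i - x j ≠ 0 := sub_ne_zero.2 fun he => hj (hx he ▸ hi)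
      have hne' : inner ℝ (x i - x j) (x i - x j) ≠ 0 := inner_self_ne_zero.2 hne
      -- This direction shifts the argument of the `i`-th ridge by exactly `δ`.
      set e : V := (δ / inner ℝ (x i - x j) (x i - x j)) • (x i - x j) with he
      have hei : inner ℝ e (x i - x j) = δ := by
        rw [he, real_inner_smul_left, div_mul_cancel₀ _ hne']
      have := ih (fun k t => g k (t + inner ℝ e (x k - x j)) - g k t) (fun k => by
        obtain ⟨B, hB⟩ := hg k
        refine ⟨2 * B, fun t => (abs_sub _ _).trans ?_⟩
        have h1 := hB t
        have h2 := hB (t + inner ℝ e (x k - x j))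
        linarith) (fun w b => by
        have h1 := h (w + e) (b - inner ℝ e (x j))
        have h2 := h w b
        have h3 : ∀ k, inner ℝ (w + e) (x k) + (b - inner ℝ e (x j)) =
            inner ℝ w (x k) + b + inner ℝ e (x k - x j) := fun k => by
          rw [inner_add_left, inner_sub_right]; ring
        simp only [h3, sub_self, inner_zero_right, add_zero] at h1
        rw [Finset.sum_sub_distrib]
        linarith) i hi
      refine ⟨g i (0 + δ) - g i 0, fun t => ?_⟩
      have h4 := this t
      simp only [hei] at h4
      exact h4
    intro i hi
    rcases Finset.mem_insert.1 hi with rfl | hi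
    · intro t
      -- With `w = 0` all ridges share the argument `b`; as the others are constant, so is the
      -- eliminated one.
      have h1 := h 0 t
      have h2 := h 0 0
      simp only [inner_zero_left, zero_add] at h1 h2
      rw [Finset.sum_congr rfl fun k hk => hs k hk t] at h1
      linarith
    · exact hs i hi

section
variable {d : ℕ} {C₁ : ℝ} {σ₀ : ℝ → ℝ}

lemma IsActivation.affine_of_deriv_const (h : IsActivation C₁ σ₀)
    (hc : ∀ t, deriv σ₀ t = deriv σ₀ 0) : ∃ a b : ℝ, ∀ t, σ₀ t = a * t + b := by
  refine ⟨deriv σ₀ 0, σ₀ 0, fun t => ?_⟩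
  have hd : ∀ s, HasDerivAt (fun s => σ₀ s - deriv σ₀ 0 * s) 0 s := fun s => by
    have := (h.differentiable s).hasDerivAt.fun_sub ((hasDerivAt_id s).const_mul (deriv σ₀ 0))
    simpa [hc s] using this
  have := is_const_of_deriv_eq_zero (fun s => (hd s).differentiableAt) (fun s => (hd s).deriv) t 0
  simp only [mul_zero, sub_zero] at this
  linarith

/-! ### The Gram matrix of the head at a Gaussian initialization -/

/-- The expectation of the kernel of the head under the standard Gaussian. -/
noncomputable def gaussKernel (σ₀ : ℝ → ℝ) (z z' : Vec d) : ℝ := ∫ ω, headKernel σ₀ z z' ω ∂(tau0 d)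

/-- The quadratic form of the Gram matrix of the head under the standard Gaussian. -/
noncomputable def gaussForm (σ₀ : ℝ → ℝ) {n : ℕ} (x : Fin n → Vec d) (v : Fin n → ℝ) : ℝ :=
  ∑ i, ∑ j, v i * v j * gaussKernel σ₀ (x i) (x j)

lemma quadLip_headKernel' (h : IsActivation C₁ σ₀) (z z' : Vec d) :
    QuadLip (2 * C₁ ^ 2 * (max ‖z‖ ‖z'‖ + 1) ^ 3) (headKernel σ₀ z z') :=
  quadLip_headKernel h (by linarith [le_max_left ‖z‖ ‖z'‖]) (by linarith [le_max_right ‖z‖ ‖z'‖])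

lemma integrable_headKernel (h : IsActivation C₁ σ₀) (z z' : Vec d) {τ : Measure (HeadParam d)}
    (hτ : IsP2 τ) : Integrable (headKernel σ₀ z z') τ :=
  (quadLip_headKernel' h z z').integrable hτ

lemma gaussForm_eq (h : IsActivation C₁ σ₀) {n : ℕ} (x : Fin n → Vec d) (v : Fin n → ℝ) :
    gaussForm σ₀ x v = ∫ ω, ∑ i, ∑ j, v i * v j * headKernel σ₀ (x i) (x j) ω ∂(tau0 d) := by
  have hi := fun i j => (integrable_headKernel h (x i) (x j)
    (isP2_stdGaussian (E := HeadParam d))).const_mul (v i * v j)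
  rw [tau0, integral_finsetSum _ fun i _ => integrable_finsetSum _ fun j _ => hi i j]
  refine Finset.sum_congr rfl fun i _ => ?_
  rw [integral_finsetSum _ fun j _ => hi i j]
  refine Finset.sum_congr rfl fun j _ => ?_
  rw [integral_const_mul]
  rfl

lemma sum_headKernel_eq (h : IsActivation C₁ σ₀) {n : ℕ} (x : Fin n → Vec d) (v : Fin n → ℝ)
    (ω : HeadParam d) : ∑ i, ∑ j, v i * v j * headKernel σ₀ (x i) (x j) ω =
      ‖∑ i, v i • gradient (head σ₀ (x i)) ω‖ ^ 2 := by
  rw [← real_inner_self_eq_norm_sq, sum_inner]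
  refine Finset.sum_congr rfl fun i _ => ?_
  rw [inner_sum]
  refine Finset.sum_congr rfl fun j _ => ?_
  rw [headKernel_eq_inner h.differentiable, real_inner_smul_left, real_inner_smul_right]
  ring

lemma gaussForm_nonneg (h : IsActivation C₁ σ₀) {n : ℕ} (x : Fin n → Vec d) (v : Fin n → ℝ) :
    0 ≤ gaussForm σ₀ x v := by
  rw [gaussForm_eq h]
  exact integral_nonneg fun ω => by simp only [sum_headKernel_eq h]; exact sq_nonneg _

lemma gaussForm_pos (h : IsActivation C₁ σ₀) (hna : ¬ ∃ a b : ℝ, ∀ t, σ₀ t = a * t + b) {n : ℕ}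
    {x : Fin n → Vec d} (hx : Function.Injective x) {v : Fin n → ℝ} (hv : v ≠ 0) :
    0 < gaussForm σ₀ x v := by
  refine (gaussForm_nonneg h x v).lt_of_ne fun h0 => hv ?_
  have hi := fun i j => (integrable_headKernel h (x i) (x j)
    (isP2_stdGaussian (E := HeadParam d))).const_mul (v i * v j)
  have hcont : Continuous fun ω : HeadParam d =>
      ∑ i, ∑ j, v i * v j * headKernel σ₀ (x i) (x j) ω :=
    continuous_finsetSum _ fun i _ => continuous_finsetSum _ fun j _ =>
      continuous_const.mul (quadLip_headKernel' h (x i) (x j)).continuous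
  rw [gaussForm_eq h, eq_comm, tau0, integral_eq_zero_iff_of_nonneg
    (fun ω => by simp only [sum_headKernel_eq h, Pi.zero_apply]; exact sq_nonneg _)
    (integrable_finsetSum _ fun i _ => integrable_finsetSum _ fun j _ => hi i j)] at h0
  -- Full support of the Gaussian upgrades almost everywhere to everywhere.
  have h1 := (hcont.ae_eq_iff_eq (stdGaussian (HeadParam d)) continuous_zero).1 h0
  have h2 : ∀ ω, ∑ i, v i * (ω (Sum.inl ()) * deriv σ₀ (affineForm (x i) ω)) = 0 := fun ω => by
    have h3 := congrFun h1 ω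
    simp only [sum_headKernel_eq h, Pi.zero_apply] at h3
    -- Only the bias coordinate of the gradient is used: it involves the bounded function `σ₀'`, as
    -- `ridge_const` requires, whereas `σ₀` itself may grow.
    have h4 := congrArg (fun y : HeadParam d => y (Sum.inr (Sum.inr ())))
      (norm_eq_zero.1 (pow_eq_zero_iff two_ne_zero |>.1 h3))
    simpa [gradient_head h.differentiable, WithLp.ofLp_sum] using h4
  have h5 := ridge_const hx Finset.univ (fun i t => v i * deriv σ₀ t)
    (fun i => ⟨|v i| * C₁, fun t => by
      rw [abs_mul]; exact mul_le_mul_of_nonneg_left (h.deriv_le t) (abs_nonneg _)⟩)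
    (fun w b => by
      have := h2 (WithLp.toLp 2 (Sum.elim (fun _ => 1) (Sum.elim (fun i => w i) fun _ => b)))
      simp only [affineForm_apply, Sum.elim_inl, Sum.elim_inr, one_mul] at this
      simpa only [PiLp.inner_apply, RCLike.inner_apply, conj_trivial, mul_comm] using this)
  funext i
  by_contra hne
  exact hna (h.affine_of_deriv_const fun t =>
    mul_left_cancel₀ hne (h5 i (Finset.mem_univ _) t))

lemma continuousOn_gaussKernel (h : IsActivation C₁ σ₀) :
    ContinuousOn (fun p : Vec d × Vec d => gaussKernel σ₀ p.1 p.2)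
      {p | ‖p.1‖ ≤ 1 ∧ ‖p.2‖ ≤ 1} := by
  have hP := isP2_stdGaussian (E := HeadParam d)
  have hint := integrable_one_add_norm_pow_stdGaussian (E := HeadParam d) 3
  intro q hq
  refine tendsto_iff_norm_sub_tendsto_zero.2 ?_
  have hb : ∀ p ∈ {p : Vec d × Vec d | ‖p.1‖ ≤ 1 ∧ ‖p.2‖ ≤ 1},
      ‖gaussKernel σ₀ p.1 p.2 - gaussKernel σ₀ q.1 q.2‖ ≤
      C₁ ^ 2 * 2 ^ 2 * (‖p.1 - q.1‖ + ‖p.2 - q.2‖) *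
        ∫ ω, (1 + ‖ω‖) ^ 3 ∂(stdGaussian (HeadParam d)) := fun p hp => by
    rw [gaussKernel, gaussKernel, tau0, ← integral_sub (integrable_headKernel h _ _ hP)
      (integrable_headKernel h _ _ hP), ← integral_const_mul]
    exact norm_integral_le_of_norm_le (hint.const_mul _) (ae_of_all _ fun ω =>
      abs_headKernel_sub_le h (by linarith [hp.2]) (by linarith [hq.1]) (by linarith [hq.2]) ω)
  refine squeeze_zero' (Eventually.of_forall fun _ => norm_nonneg _)
    (eventually_mem_nhdsWithin.mono hb) ?_
  have hc : Continuous fun p : Vec d × Vec d =>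
      C₁ ^ 2 * 2 ^ 2 * (‖p.1 - q.1‖ + ‖p.2 - q.2‖) *
        ∫ ω, (1 + ‖ω‖) ^ 3 ∂(stdGaussian (HeadParam d)) := by fun_prop
  simpa using (hc.tendsto q).mono_left nhdsWithin_le_nhds

lemma IsData.injective {Cmax : ℝ} (hC : Cmax < 1) {n : ℕ} {x : Fin n → Vec d}
    (hx : IsData Cmax x) : Function.Injective x := by
  intro i j hij
  by_contra hne
  have := hx.2 i j hne
  rw [hij, real_inner_self_eq_norm_sq, hx.1 j] at this
  linarith

/-- Distinct data points satisfy `‖xᵢ - xⱼ‖² = 2 - 2⟨xᵢ, xⱼ⟩ ≥ ε²`, so each ball of radius `ε / 2`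
in a finite cover of the sphere contains at most one of them. -/
lemma exists_card_le_of_isData (d : ℕ) {Cmax : ℝ} (hC : Cmax < 1) :
    ∃ N : ℕ, ∀ (n : ℕ) (x : Fin n → Vec d), IsData Cmax x → n ≤ N := by
  set ε := Real.sqrt (2 * (1 - Cmax)) with hε
  have hε0 : 0 < ε := Real.sqrt_pos.2 (by linarith)
  have hε2 : ε ^ 2 = 2 * (1 - Cmax) := Real.sq_sqrt (by linarith)
  obtain ⟨t, -, htf, htc⟩ := (isCompact_sphere (0 : Vec d) 1).finite_cover_balls (half_pos hε0)
  refine ⟨t.ncard, fun n x hx => ?_⟩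
  have hc : ∀ i, ∃ y : t, dist (x i) y < ε / 2 := fun i => by
    obtain ⟨y, hy, h⟩ := mem_iUnion₂.1 (htc (by simp [hx.1 i] : x i ∈ Metric.sphere (0 : Vec d) 1))
    exact ⟨⟨y, hy⟩, h⟩
  choose f hf using hc
  have hinj : Function.Injective f := fun i j hij => by
    by_contra hne
    have h1 := hf i
    have h2 := hf j
    rw [hij] at h1
    have h3 := dist_triangle_right (x i) (x j) (f j)
    rw [dist_eq_norm] at h3
    have h4 := norm_sub_sq_real (x i) (x j)
    rw [hx.1 i, hx.1 j] at h4
    have h5 := hx.2 i j hne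
    nlinarith [norm_nonneg (x i - x j)]
  have := htf.to_subtype
  have := Nat.card_le_card_of_injective f hinj
  simpa using this

lemma gaussForm_smul {n : ℕ} (x : Fin n → Vec d) (c : ℝ) (v : Fin n → ℝ) :
    gaussForm σ₀ x (c • v) = c ^ 2 * gaussForm σ₀ x v := by
  simp only [gaussForm, Finset.mul_sum, Pi.smul_apply, smul_eq_mul]
  exact Finset.sum_congr rfl fun i _ => Finset.sum_congr rfl fun j _ => by ring

lemma isCompact_data (d n : ℕ) (Cmax : ℝ) :
    IsCompact {p : (Fin n → Vec d) × (Fin n → ℝ) | IsData Cmax p.1 ∧ ∑ i, p.2 i ^ 2 = 1} := by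
  refine Metric.isCompact_of_isClosed_isBounded ?_ ?_
  · simp only [IsData, Set.ofPred_and, Set.ofPred_forall]
    refine IsClosed.inter (IsClosed.inter (isClosed_iInter fun i => ?_)
      (isClosed_iInter fun i => isClosed_iInter fun j => isClosed_iInter fun _ => ?_)) ?_
    · exact isClosed_eq (by fun_prop) continuous_const
    · exact isClosed_le (by fun_prop) continuous_const
    · exact isClosed_eq (by fun_prop) continuous_const
  · refine (Metric.isBounded_closedBall (x := 0) (r := 1)).subset fun p hp => ?_
    rw [mem_closedBall_zero_iff, Prod.norm_def]
    refine max_le ((pi_norm_le_iff_of_nonneg zero_le_one).2 fun i => (hp.1.1 i).le)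
      ((pi_norm_le_iff_of_nonneg zero_le_one).2 fun i => ?_)
    rw [Real.norm_eq_abs, ← sq_le_one_iff_abs_le_one, ← hp.2]
    exact Finset.single_le_sum (f := fun i => p.2 i ^ 2) (fun j _ => sq_nonneg _)
      (Finset.mem_univ i)

/-- The form is continuous and positive on the compact set of admissible data paired with unit
vectors, so it attains a positive minimum; homogeneity extends this to all `v`. -/
lemma exists_gaussForm_lower_bound (h : IsActivation C₁ σ₀)
    (hna : ¬ ∃ a b : ℝ, ∀ t, σ₀ t = a * t + b) {Cmax : ℝ} (hC : Cmax < 1) (n : ℕ) :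
    ∃ Λ : ℝ, 0 < Λ ∧ ∀ x : Fin n → Vec d, IsData Cmax x → ∀ v : Fin n → ℝ,
      Λ * ∑ i, v i ^ 2 ≤ gaussForm σ₀ x v := by
  set K := {p : (Fin n → Vec d) × (Fin n → ℝ) | IsData Cmax p.1 ∧ ∑ i, p.2 i ^ 2 = 1} with hK
  have hcont : ContinuousOn (fun p : (Fin n → Vec d) × (Fin n → ℝ) => gaussForm σ₀ p.1 p.2) K := by
    refine continuousOn_finsetSum _ fun i _ => continuousOn_finsetSum _ fun j _ =>
      ContinuousOn.mul (Continuous.continuousOn (by fun_prop)) ?_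
    exact (continuousOn_gaussKernel h).comp
      (f := fun p : (Fin n → Vec d) × (Fin n → ℝ) => (p.1 i, p.1 j))
      (Continuous.continuousOn (by fun_prop)) fun p hp => ⟨(hp.1.1 i).le, (hp.1.1 j).le⟩
  have hmin : ∃ Λ : ℝ, 0 < Λ ∧ ∀ p ∈ K, Λ ≤ gaussForm σ₀ p.1 p.2 := by
    rcases K.eq_empty_or_nonempty with he | hne
    -- This covers `n = 0` and the absence of admissible data, where any positive constant serves.
    · exact ⟨1, one_pos, by simp [he]⟩
    · obtain ⟨p, hp, hpm⟩ := (isCompact_data d n Cmax).exists_isMinOn hne hcont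
      refine ⟨_, gaussForm_pos h hna (hp.1.injective hC) (v := p.2) fun h0 => ?_, hpm⟩
      have := hp.2
      simp [h0] at this
  obtain ⟨Λ, hΛ, hΛK⟩ := hmin
  refine ⟨Λ, hΛ, fun x hx v => ?_⟩
  set S := ∑ i, v i ^ 2 with hS
  have hS0 : 0 ≤ S := Finset.sum_nonneg fun i _ => sq_nonneg _
  rcases hS0.eq_or_lt with h0 | hpos
  · rw [← h0, mul_zero]
    exact gaussForm_nonneg h x v
  · have hsq : (Real.sqrt S)⁻¹ ^ 2 = S⁻¹ := by rw [inv_pow, Real.sq_sqrt hS0]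
    have h1 := hΛK (x, (Real.sqrt S)⁻¹ • v) ⟨hx, by
      simp only [Pi.smul_apply, smul_eq_mul, mul_pow, ← Finset.mul_sum, hsq]
      exact inv_mul_cancel₀ hpos.ne'⟩
    simp only [gaussForm_smul, hsq] at h1
    rwa [← div_eq_inv_mul, le_div_iff₀ hpos] at h1

lemma exists_uniform_gaussForm_lower_bound (h : IsActivation C₁ σ₀)
    (hna : ¬ ∃ a b : ℝ, ∀ t, σ₀ t = a * t + b) {Cmax : ℝ} (hC : Cmax < 1) :
    ∃ Λ : ℝ, 0 < Λ ∧ ∀ (n : ℕ) (x : Fin n → Vec d), IsData Cmax x → ∀ v : Fin n → ℝ,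
      Λ * ∑ i, v i ^ 2 ≤ gaussForm σ₀ x v := by
  obtain ⟨N, hN⟩ := exists_card_le_of_isData d hC
  choose f hf0 hf using fun n => exists_gaussForm_lower_bound (d := d) h hna hC n
  have hne : (Finset.range (N + 1)).Nonempty := ⟨0, by simp⟩
  refine ⟨(Finset.range (N + 1)).inf' hne f, (Finset.lt_inf'_iff hne).2 fun n _ => hf0 n,
    fun n x hx v => le_trans ?_ (hf n x hx v)⟩
  exact mul_le_mul_of_nonneg_right
    (Finset.inf'_le f (Finset.mem_range.2 (Nat.lt_succ_of_le (hN n x hx))))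
    (Finset.sum_nonneg fun i _ => sq_nonneg _)

end

/-! ### Perturbation of the Gram matrix of the head -/

/-- The fourth moment of `1 + ‖·‖` under the standard Gaussian. -/
noncomputable def gaussMoment (ι : Type*) [Fintype ι] : ℝ :=
  ∫ θ, (1 + ‖θ‖) ^ 4 ∂(stdGaussian (EuclideanSpace ℝ ι))

lemma gaussMoment_nonneg (ι : Type*) [Fintype ι] : 0 ≤ gaussMoment ι :=
  integral_nonneg fun _ => by positivity

/-- A bound for `(r² + r (1 + M) / 2) / r` over `r ≤ √d`, `M` a moment of the standard Gaussian. -/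
noncomputable def driftConst (d : ℕ) (ι : Type*) [Fintype ι] : ℝ :=
  Real.sqrt d + (1 + gaussMoment ι) / 2

lemma driftConst_nonneg (d : ℕ) (ι : Type*) [Fintype ι] : 0 ≤ driftConst d ι := by
  have := gaussMoment_nonneg ι
  unfold driftConst
  positivity

/-- A bound for `‖Z_ν(x, s) - x‖ / r` for `ν` at distance `r ≤ √d` from `ν₀`. -/
noncomputable def flowConst (d : ℕ) (C₁ α : ℝ) : ℝ :=
  2 * (α * (2 * C₁ * driftConst d (ResIdx d))) *
    Real.exp (α * (2 * C₁ * driftConst d (ResIdx d) * Real.sqrt d))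

/-- The Lipschitz constant `C_G(d, α)` of the Gram matrix of the head. -/
noncomputable def gramConst (d : ℕ) (C₁ α : ℝ) : ℝ :=
  1 + 2 * C₁ ^ 2 * (2 + flowConst d C₁ α * Real.sqrt d) ^ 3 * driftConst d (HeadIdx d) +
    C₁ ^ 2 * (2 + flowConst d C₁ α * Real.sqrt d) ^ 2 * (2 * flowConst d C₁ α) *
      gaussMoment (HeadIdx d)

section
variable {d : ℕ} {C₁ α : ℝ} {σ₀ : ℝ → ℝ}

lemma flowConst_nonneg (hC : 0 ≤ C₁) (hα : 0 ≤ α) : 0 ≤ flowConst d C₁ α := by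
  have := driftConst_nonneg d (ResIdx d)
  unfold flowConst
  positivity

/-- The summand `1` keeps the constant positive even for `C₁ = 0`, since it appears in the
denominator of `rMax`. -/
lemma one_le_gramConst (hC : 0 ≤ C₁) (hα : 0 ≤ α) : 1 ≤ gramConst d C₁ α := by
  have h1 := driftConst_nonneg d (HeadIdx d)
  have h2 := flowConst_nonneg (d := d) hC hα
  have h3 := gaussMoment_nonneg (HeadIdx d)
  have h4 : 0 ≤ 2 * C₁ ^ 2 * (2 + flowConst d C₁ α * Real.sqrt d) ^ 3 * driftConst d (HeadIdx d) +
    C₁ ^ 2 * (2 + flowConst d C₁ α * Real.sqrt d) ^ 2 * (2 * flowConst d C₁ α) *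
      gaussMoment (HeadIdx d) := by positivity
  unfold gramConst
  linarith

lemma QuadLip.norm_integral_sub_stdGaussian_le {ι F : Type*} [Fintype ι] [NormedAddCommGroup F]
    [NormedSpace ℝ F] {L : ℝ} {f : EuclideanSpace ℝ ι → F} (hf : QuadLip L f) (hL : 0 ≤ L)
    {μ : Measure (EuclideanSpace ℝ ι)} (hμ : IsP2 μ) {r : ℝ} (hr : 0 ≤ r) (hrd : r ≤ Real.sqrt d)
    (h : W2 μ (stdGaussian _) ≤ ENNReal.ofReal r) :
    ‖∫ x, f x ∂μ - ∫ x, f x ∂(stdGaussian _)‖ ≤ L * (driftConst d ι * r) := by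
  refine (hf.norm_integral_sub_le hL hμ isP2_stdGaussian
    (integrable_one_add_norm_pow_stdGaussian 4) hr h).trans (mul_le_mul_of_nonneg_left ?_ hL)
  have := mul_le_mul_of_nonneg_right hrd hr
  unfold driftConst gaussMoment
  linarith

/-- The Gaussian drift is zero, so the drift under `ν` is itself a difference of integrals and is
controlled by `W2`. In the exponential `r` is replaced by `√d`, leaving a bound linear in `r`. -/
lemma norm_Z_sub_le_of_W2sup_le (h : IsActivation C₁ σ₀) (hα : 0 ≤ α)
    {ν : ℝ → Measure (ResParam d)} (hν : IsCP2 ν) {r : ℝ} (hr : 0 ≤ r) (hrd : r ≤ Real.sqrt d)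
    (hW : W2sup ν (nu0 d) ≤ ENNReal.ofReal r) {x : Vec d} (hx : ‖x‖ = 1) {s : ℝ}
    (hs : s ∈ Icc (0 : ℝ) 1) : ‖Z α σ₀ ν x s - x‖ ≤ flowConst d C₁ α * r := by
  have hC := h.nonneg
  have hD := driftConst_nonneg d (ResIdx d)
  refine (norm_Z_sub_le hα (k := 2 * C₁ * driftConst d (ResIdx d) * r) (by positivity)
    (fun t ht z => ?_) hx hs).trans ?_
  · have h1 : W2 (ν t) (stdGaussian (ResParam d)) ≤ ENNReal.ofReal r :=
      (le_iSup₂ (f := fun s (_ : s ∈ Icc (0 : ℝ) 1) => W2 (ν s) (nu0 d s)) t ht).trans hW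
    have h2 := (quadLip_resBlock h z).norm_integral_sub_stdGaussian_le (by positivity) (hν.1 t ht)
      hr hrd h1
    have h3 : ∫ θ, resBlock σ₀ z θ ∂(stdGaussian (ResParam d)) = 0 := integral_resBlock_nu0 z 0
    rw [h3, sub_zero] at h2
    linarith
  · have h1 : Real.exp (α * (2 * C₁ * driftConst d (ResIdx d) * r)) ≤
        Real.exp (α * (2 * C₁ * driftConst d (ResIdx d) * Real.sqrt d)) :=
      Real.exp_le_exp.2 (by gcongr)
    have h2 : 0 ≤ 2 * (α * (2 * C₁ * driftConst d (ResIdx d) * r)) := by positivity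
    refine (mul_le_mul_of_nonneg_left h1 h2).trans (le_of_eq ?_)
    unfold flowConst
    ring

/-- First `τ` is replaced by the Gaussian at fixed final states, then the states are moved back to
the data under the Gaussian. The order matters: the second move has cubic growth in `ω`, which `τ`
need not integrate. -/
lemma abs_G2_sub_le (h : IsActivation C₁ σ₀) (hα : 0 ≤ α) {n : ℕ} {x : Fin n → Vec d}
    (hx : ∀ i, ‖x i‖ = 1) {τ : Measure (HeadParam d)} {ν : ℝ → Measure (ResParam d)}
    (hτ : IsP2 τ) (hν : IsCP2 ν) {r t : ℝ} (hr : 0 ≤ r) (hrd : r ≤ Real.sqrt d)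
    (hW : W2sup ν (nu0 d) ≤ ENNReal.ofReal r) (ht : 0 ≤ t) (htd : t ≤ Real.sqrt d)
    (hWτ : W2 τ (tau0 d) ≤ ENNReal.ofReal t) (i j : Fin n) :
    |G2 α σ₀ x τ ν i j - G2 α σ₀ x (tau0 d) (nu0 d) i j| ≤ gramConst d C₁ α * (r + t) := by
  have hC := h.nonneg
  have hF := flowConst_nonneg (d := d) hC hα
  have hM := gaussMoment_nonneg (HeadIdx d)
  have hD := driftConst_nonneg d (HeadIdx d)
  have h1 : (1 : ℝ) ∈ Icc (0 : ℝ) 1 := ⟨zero_le_one, le_rfl⟩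
  have hP := isP2_stdGaussian (E := HeadParam d)
  set Q := 2 + flowConst d C₁ α * Real.sqrt d with hQ
  have hQ0 : 0 ≤ Q := by positivity
  have hZ := fun i => norm_Z_sub_le_of_W2sup_le h hα hν hr hrd hW (hx i) h1
  have hFr : flowConst d C₁ α * r ≤ flowConst d C₁ α * Real.sqrt d := by gcongr
  have hZQ : ∀ i, ‖Z α σ₀ ν (x i) 1‖ + 1 ≤ Q := fun i => by
    have h2 := norm_add_le (Z α σ₀ ν (x i) 1 - x i) (x i)
    rw [sub_add_cancel, hx i] at h2
    linarith [hZ i]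
  have hxQ : ∀ i, ‖x i‖ + 1 ≤ Q := fun i => by
    rw [hx i]
    have : 0 ≤ flowConst d C₁ α * Real.sqrt d := by positivity
    linarith
  rw [G2_apply h.differentiable, G2_apply h.differentiable, Z_nu0 hα (hx i) h1,
    Z_nu0 hα (hx j) h1]
  have e1 := (quadLip_headKernel h (hZQ i) (hZQ j)).norm_integral_sub_stdGaussian_le
    (by positivity) hτ ht htd hWτ
  have e2 : ‖∫ ω, headKernel σ₀ (Z α σ₀ ν (x i) 1) (Z α σ₀ ν (x j) 1) ω ∂(stdGaussian (HeadParam d))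
      - ∫ ω, headKernel σ₀ (x i) (x j) ω ∂(stdGaussian (HeadParam d))‖ ≤
      C₁ ^ 2 * Q ^ 2 * (2 * (flowConst d C₁ α * r)) * gaussMoment (HeadIdx d) := by
    rw [← integral_sub (integrable_headKernel h _ _ hP) (integrable_headKernel h _ _ hP),
      gaussMoment, ← integral_const_mul]
    refine norm_integral_le_of_norm_le
      ((integrable_one_add_norm_pow_stdGaussian 4).const_mul _) (ae_of_all _ fun ω => ?_)
    refine (abs_headKernel_sub_le h (hZQ j) (hxQ i) (hxQ j) ω).trans ?_
    have h2 : (1 + ‖ω‖) ^ 3 ≤ (1 + ‖ω‖) ^ 4 :=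
      pow_le_pow_right₀ (by linarith [norm_nonneg ω]) (by norm_num)
    have h3 : ‖Z α σ₀ ν (x i) 1 - x i‖ + ‖Z α σ₀ ν (x j) 1 - x j‖ ≤
      2 * (flowConst d C₁ α * r) := by linarith [hZ i, hZ j]
    gcongr
  refine (abs_sub_le _ _ _).trans ((add_le_add e1 e2).trans ?_)
  have p1 : 0 ≤ 2 * C₁ ^ 2 * Q ^ 3 * driftConst d (HeadIdx d) := by positivity
  have p2 : 0 ≤ C₁ ^ 2 * Q ^ 2 * (2 * flowConst d C₁ α) * gaussMoment (HeadIdx d) := by positivity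
  have p3 := mul_nonneg p1 hr
  have p4 := mul_nonneg p2 ht
  rw [gramConst, ← hQ]
  linarith

lemma le_lambdaMin_G2_tau0_nu0 (h : IsActivation C₁ σ₀) (hα : 0 ≤ α) {n : ℕ} (hn : 0 < n)
    {x : Fin n → Vec d} (hx : ∀ i, ‖x i‖ = 1) {Λ : ℝ}
    (hΛ : ∀ v : Fin n → ℝ, Λ * ∑ i, v i ^ 2 ≤ gaussForm σ₀ x v) :
    Λ ≤ lambdaMin (G2 α σ₀ x (tau0 d) (nu0 d)) := by
  have h1 : (1 : ℝ) ∈ Icc (0 : ℝ) 1 := ⟨zero_le_one, le_rfl⟩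
  rw [le_lambdaMin_iff hn (G2_isHermitian _ _ _)]
  intro v
  refine (hΛ v).trans (le_of_eq ?_)
  refine Finset.sum_congr rfl fun i _ => Finset.sum_congr rfl fun j _ => ?_
  rw [G2_apply h.differentiable, Z_nu0 hα (hx i) h1, Z_nu0 hα (hx j) h1]
  rfl

lemma lambdaMin_G2_ge (h : IsActivation C₁ σ₀) (hα : 0 < α) {n : ℕ} (hn : 0 < n)
    {x : Fin n → Vec d} (hx : ∀ i, ‖x i‖ = 1) {Λ : ℝ} (hΛ0 : 0 ≤ Λ) {τ : Measure (HeadParam d)}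
    {ν : ℝ → Measure (ResParam d)} (hτ : IsP2 τ) (hν : IsCP2 ν)
    (hW : W2sup ν (nu0 d) ≤ ENNReal.ofReal (rMax d n Λ (gramConst d C₁ α)))
    (hWτ : W2 τ (tau0 d) ≤ ENNReal.ofReal (rMax d n Λ (gramConst d C₁ α))) :
    lambdaMin (G2 α σ₀ x (tau0 d) (nu0 d)) - Λ / 2 ≤ lambdaMin (G2 α σ₀ x τ ν) := by
  have hG : 0 < gramConst d C₁ α := zero_lt_one.trans_le (one_le_gramConst h.nonneg hα.le)
  have hn' : (0 : ℝ) < n := Nat.cast_pos.2 hn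
  have hr0 : 0 ≤ rMax d n Λ (gramConst d C₁ α) := le_min (Real.sqrt_nonneg _) (by positivity)
  have hr1 : rMax d n Λ (gramConst d C₁ α) ≤ Real.sqrt d := min_le_left _ _
  have hr2 : rMax d n Λ (gramConst d C₁ α) ≤ Λ / (4 * n * gramConst d C₁ α) := min_le_right _ _
  have h1 := lambdaMin_sub_le hn (G2_isHermitian x (tau0 d) (nu0 d)) (G2_isHermitian x τ ν)
    (abs_G2_sub_le h hα.le hx hτ hν hr0 hr1 hW hr0 hr1 hWτ)
  refine le_trans (sub_le_sub_left ?_ _) h1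
  -- Each entry moves by at most `2 * gramConst * rMax`; times `n` this is at most `Λ / 2`, which
  -- explains the factor `4` in `rMax`.
  rw [le_div_iff₀ (by positivity)] at hr2
  linarith

end

end MeanFieldResNet

open MeanFieldResNet MeasureTheory in
theorem mainTheorem5 (d : ℕ) (C₁ : ℝ) :
    ∃ CG : ℝ → ℝ, (∀ α, 0 < α → 0 < CG α) ∧
      ∀ σ₀ : ℝ → ℝ, IsActivation C₁ σ₀ → ∀ Cmax : ℝ, Cmax < 1 →
        ∃ Λ : ℝ, 0 ≤ Λ ∧ ((¬ ∃ a b : ℝ, ∀ t, σ₀ t = a * t + b) → 0 < Λ) ∧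
          ∀ α : ℝ, 0 < α → ∀ n : ℕ, 0 < n → ∀ x : Fin n → Vec d, IsData Cmax x →
            Λ ≤ lambdaMin (G2 α σ₀ x (tau0 d) (nu0 d)) ∧
            lambdaMin (G2 α σ₀ x (tau0 d) (nu0 d)) ≤ lambdaMin (G α σ₀ x (tau0 d) (nu0 d)) ∧
            ∀ (τ : Measure (HeadParam d)) (ν : ℝ → Measure (ResParam d)), IsP2 τ → IsCP2 ν →
              (W2sup ν (nu0 d) ≤ ENNReal.ofReal (Real.sqrt d) →
                W2 τ (tau0 d) ≤ ENNReal.ofReal (Real.sqrt d) →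
                ∀ i j, |G2 α σ₀ x τ ν i j - G2 α σ₀ x (tau0 d) (nu0 d) i j| ≤
                  CG α * ((W2sup ν (nu0 d)).toReal + (W2 τ (tau0 d)).toReal)) ∧
              (W2sup ν (nu0 d) ≤ ENNReal.ofReal (rMax d n Λ (CG α)) →
                W2 τ (tau0 d) ≤ ENNReal.ofReal (rMax d n Λ (CG α)) →
                lambdaMin (G α σ₀ x (tau0 d) (nu0 d)) / 2 ≤ lambdaMin (G2 α σ₀ x τ ν) ∧
                Λ / 2 ≤ lambdaMin (G2 α σ₀ x τ ν)) := by
  -- A negative `C₁` admits no activation, but a positive `CG` must still be supplied.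
  rcases lt_or_ge C₁ 0 with hneg | hC
  · exact ⟨fun _ => 1, fun _ _ => one_pos, fun σ₀ h => absurd h.nonneg hneg.not_ge⟩
  refine ⟨gramConst d C₁, fun α hα => zero_lt_one.trans_le (one_le_gramConst hC hα.le),
    fun σ₀ h Cmax hCmax => ?_⟩
  obtain ⟨Λ, hΛ0, hΛpos, hΛ⟩ : ∃ Λ : ℝ, 0 ≤ Λ ∧
      ((¬ ∃ a b : ℝ, ∀ t, σ₀ t = a * t + b) → 0 < Λ) ∧
      ∀ (n : ℕ) (x : Fin n → Vec d), IsData Cmax x → ∀ v : Fin n → ℝ,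
        Λ * ∑ i, v i ^ 2 ≤ gaussForm σ₀ x v := by
    by_cases hna : ∃ a b : ℝ, ∀ t, σ₀ t = a * t + b
    · exact ⟨0, le_rfl, fun hn => absurd hna hn, fun n x _ v => by
        rw [zero_mul]; exact gaussForm_nonneg h x v⟩
    · obtain ⟨Λ, h1, h2⟩ := exists_uniform_gaussForm_lower_bound (d := d) h hna hCmax
      exact ⟨Λ, h1.le, fun _ => h1, h2⟩
  refine ⟨Λ, hΛ0, hΛpos, fun α hα n hn x hx => ?_⟩
  have hmin := le_lambdaMin_G2_tau0_nu0 h hα.le hn hx.1 (hΛ n x hx)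
  refine ⟨hmin, by rw [G_tau0_nu0], fun τ ν hτ hν => ⟨fun hW hWτ => ?_, fun hW hWτ => ?_⟩⟩
  · have hs := Real.sqrt_nonneg (d : ℝ)
    -- The radii are the distances themselves, which the hypotheses make finite, so `toReal` loses
    -- nothing.
    exact abs_G2_sub_le h hα.le hx.1 hτ hν ENNReal.toReal_nonneg
      (ENNReal.toReal_le_of_le_ofReal hs hW)
      (ENNReal.ofReal_toReal (hW.trans_lt ENNReal.ofReal_lt_top).ne).ge ENNReal.toReal_nonneg
      (ENNReal.toReal_le_of_le_ofReal hs hWτ)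
      (ENNReal.ofReal_toReal (hWτ.trans_lt ENNReal.ofReal_lt_top).ne).ge
  · rw [G_tau0_nu0]
    have := lambdaMin_G2_ge h hα hn hx.1 hΛ0 hτ hν hW hWτ
    constructor <;> linarith
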